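/- \textbf{Setting.} Agents $i\in\{1,\dots,I\}$ choose $x_i\in\Omega_i\subseteq\mathbb R^{n_{x_i}}$; $x=\mathrm{col}(x_i)$, $\Omega=\prod_i\Omega_i$. Agent $i$ has cost $f_i(x)=\bar f_i\big(x_i,(\sigma_q(x))_{q:(q,i)\in\mathcal E^{\sigma}_{\rm I}}\big)$, with $\bar f_i$ differentiable and affine aggregation $\sigma_q(x)=\sum_i (B_{q,i}x_i+b_{q,i})$, $q=1,\dots,Q$. The actions are coupled by the affine constraints $\sum_i A_{m,i}x_i=\sum_i a_{m,i}$, $m=1,\dots,M$, written $Ax=a$. Here $\mathcal E^{\lambda}_{\rm I}\subseteq\{1,\dots,M\}\times\{1,\dots,I\}$ and $\mathcal E^{\sigma}_{\rm I}\subseteq\{1,\dots,Q\}\times\{1,\dots,I\}$ are interference edge sets with $A_{m,i}=0,\ a_{m,i}=0$ for $(m,i)\notin\mathcal E^\lambda_{\rm I}$ and $B_{q,i}=0,\ b_{q,i}=0$ for $(q,i)\notin\mathcal E^\sigma_{\rm I}$. Let $F(x)=\mathrm{col}(\nabla_{x_i}f_i(x))$ and $\mathcal X=\Omega\cap\{x: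 Ax=a\}$. A point $x\in\mathcal X$ is a generalized Nash equilibrium (GNE) if, for every $i$, $x_i$ minimizes $f_i(\cdot,x_{-i})$ over $\{y:(y,x_{-i})\in\mathcal X\}$; it is a variational GNE (v-GNE) if, in addition, there is a single $\lambda$ with $0\in\nabla_{x_i}f_i(x)+\mathsf N_{\Omega_i}(x_i)+\sum_m A_{m,i}^\top\lambda_m$ for all $i$. The KKT conditions for $(x,\lambda)$ are $0\in F(x)+\mathsf N_\Omega(x)+A^\top\lambda$ and $Ax=a$. \textbf{Estimates.} There are estimate edge sets $\mathcal E^\lambda_{\rm E}\supseteq\mathcal E^\lambda_{\rm I}$, $\mathcal E^\sigma_{\rm E}\supseteq\mathcal E^\sigma_{\rm I}$: agent $i$ keeps $\boldsymbol\lambda_{i,m},\boldsymbol z_{i,m}$ if and only if $(m,i)\in\mathcal E^\lambda_{\rm E}$, and $\boldsymbol\sigma_{i,q}$ if and only if $(q,i)\in\mathcal E^\sigma_{\rm E}$. For each $m$ (each $q$) a design graph on the agents keeping an estimate of block $m$ (block $q$), a subgraph of the communication graph, carries a weight matrix $W$ with $W_{ij}>0$ if $(j,i)$ is an edge and $W_{ij}=0$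 otherwise. $\boldsymbol L^\lambda,\boldsymbol L^\sigma$ are the stacked in-degree Laplacians, e.g. $(\boldsymbol L^\sigma\boldsymbol\sigma)_{i,q}=\sum_j W^\sigma_{q,ij}(\boldsymbol\sigma_{i,q}-\boldsymbol\sigma_{j,q})$; $\boldsymbol{\mathcal E}^\sigma(\cdot),\boldsymbol{\mathcal E}^\lambda(\cdot)$ map a vector to the stack in which every copy of each block equals that block. Let $N_q$ be the number of agents keeping $\sigma_q$, $(\boldsymbol Ax)_{i,m}=A_{m,i}x_i$, $\boldsymbol a_{i,m}=a_{m,i}$, $(\boldsymbol Bx)_{i,q}=N_qB_{q,i}x_i$, $\boldsymbol b_{i,q}=N_qb_{q,i}$. With $\tilde{\boldsymbol\sigma}_i$ the estimates $(\boldsymbol\sigma_{i,q})_q$ kept by agent $i$ and $\tilde B_i=\mathrm{col}(B_{q,i})_{q:(q,i)\in\mathcal E^\sigma_{\rm E}}$, the extended pseudo-gradient is $$\tilde{\boldsymbol F}(x,\boldsymbol\sigma)=\mathrm{col}\big(\nabla_{x_i}\bar f_i(x_i,\tilde{\boldsymbol\sigma}_i)+\tilde B_i^\top\nabla_{\tilde{\boldsymbol\sigma}_i}\bar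 f_i(x_i,\tilde{\boldsymbol\sigma}_i)\big)_i .$$ \textbf{Iteration.} From arbitrary $x^0,\boldsymbol z^0,\boldsymbol\lambda^0$ and $\boldsymbol\sigma^0=\boldsymbol Bx^0+\boldsymbol b$, $$\begin{aligned}x^{k+1}&=\mathrm{proj}_\Omega\big(x^k-\beta(\alpha\tilde{\boldsymbol F}(x^k,\boldsymbol\sigma^k)+\boldsymbol B^\top\boldsymbol L^\sigma\boldsymbol\sigma^k+\boldsymbol A^\top\boldsymbol\lambda^k)\big),\\ \boldsymbol\sigma^{k+1}&=\boldsymbol\sigma^k-\beta\boldsymbol L^\sigma\boldsymbol\sigma^k+\boldsymbol B(x^{k+1}-x^k),\\ \boldsymbol z^{k+1}&=\boldsymbol z^k+\beta\boldsymbol L^\lambda\boldsymbol\lambda^k,\\ \boldsymbol\lambda^{k+1}&=\boldsymbol\lambda^k-\beta\big(\boldsymbol L^\lambda(2\boldsymbol z^{k+1}-\boldsymbol z^k)-\boldsymbol A(2x^{k+1}-x^k)+\boldsymbol a\big).\end{aligned}$$ \textbf{Theorem.} Assume: each $\Omega_i$ is closed and convex; each $f_i$ is continuous, and convex and differentiable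 in $x_i$; $\mathcal X\neq\varnothing$ and Slater's condition holds (some point of the relative interior of $\Omega$ satisfies $Ax=a$); $F$ is $\mu$-strongly monotone and $\theta$-Lipschitz and $\tilde{\boldsymbol F}$ is $\theta$-Lipschitz, for some $\mu,\theta>0$; the dual design graphs are undirected and connected with symmetric weights; the aggregation design graphs are strongly connected with balanced weights. Then there is $\alpha_0>0$ such that for every $\alpha\in(0,\alpha_0)$ there is $\beta_0>0$ such that for every $\beta\in(0,\beta_0)$ and all initial conditions as above, the sequence $(x^k,\boldsymbol\sigma^k,\boldsymbol z^k,\boldsymbol\lambda^k)$ converges to a point $(x^\star,\boldsymbol{\mathcal E}^\sigma(\sigma(x^\star)),\boldsymbol z^\star,\boldsymbol{\mathcal E}^\lambda(\alpha\lambda^\star))$, where $(x^\star,\lambda^\star)$ satisfies the KKT conditions; hence $x^\star$ is the unique v-GNE of the game. -/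

import Mathlib

open Filter Topology

noncomputable section

/-! ### Block vectors, projections, normal cones -/

/-- `ℝⁿ` with its Euclidean norm. -/
abbrev Vec (n : ℕ) : Type := EuclideanSpace ℝ (Fin n)

/-- Column vectors `col(y₁, …, y_P)` with blocks `y_p ∈ ℝ^{n_p}`, with the Euclidean norm. -/
abbrev BlockVec {P : ℕ} (n : Fin P → ℕ) : Type := PiLp 2 (fun p => Vec (n p))

/-- The blocks `(y_p)` with `p` a neighbor of the agent `i` in the bipartite graph with edge set
`S ⊆ {1,…,P} × {1,…,I}`, stacked in one vector with the Euclidean norm. -/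
abbrev NeighborVec {I P : ℕ} (n : Fin P → ℕ) (S : Finset (Fin P × Fin I)) (i : Fin I) : Type :=
  PiLp 2 (fun p : {p : Fin P // (p, i) ∈ S} => Vec (n p.1))

/-- `(y, x_{-i})`: the vector `x` with its `i`-th block replaced by `y`. -/
def replaceBlock {P : ℕ} {n : Fin P → ℕ} (x : BlockVec n) (i : Fin P) (y : Vec (n i)) :
    BlockVec n :=
  WithLp.toLp 2 (Function.update x.ofLp i y)

/-- `v` is a point of `K` at minimal distance from `u`. -/
def IsMetricProj {E : Type*} [NormedAddCommGroup E] (K : Set E) (u v : E) : Prop :=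
  v ∈ K ∧ ∀ w ∈ K, ‖u - v‖ ≤ ‖u - w‖

/-- The projection onto `K` (used only for nonempty closed convex sets of a Euclidean space, where
the nearest point exists and is unique). -/
def metricProj {E : Type*} [NormedAddCommGroup E] (K : Set E) (u : E) : E :=
  Classical.epsilon (IsMetricProj K u)

theorem isMetricProj_metricProj {E : Type*} [NormedAddCommGroup E] [ProperSpace E] {K : Set E}
    (hK : IsClosed K) (hne : K.Nonempty) (u : E) : IsMetricProj K u (metricProj K u) := by
  refine Classical.epsilon_spec (p := IsMetricProj K u) ?_
  obtain ⟨v, hv, h⟩ := hK.exists_infDist_eq_dist hne u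
  refine ⟨v, hv, fun w hw => ?_⟩
  rw [← dist_eq_norm, ← dist_eq_norm, ← h]
  exact Metric.infDist_le_dist_of_mem hw

/-- The normal cone of `K` at `x` (empty for `x ∉ K`). -/
def normalCone {E : Type*} [NormedAddCommGroup E] [InnerProductSpace ℝ E] (K : Set E) (x : E) :
    Set E :=
  {v | x ∈ K ∧ ∀ z ∈ K, inner ℝ v (z - x) ≤ 0}

/-! ### Generalized games -/

/-- A generalized game among `I` agents with actions `x_i ∈ ℝ^{n_{x_i}}`, costs `f_i(x_i, x_{-i})`,
local feasible sets `Ω_i`, and the affine equality coupling constraints `A x = a`, split into `M`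
blocks `∑_i A_{m,i} x_i = ∑_i a_{m,i}`. -/
structure GeneralizedGame {I M : ℕ} (nx : Fin I → ℕ) (nlam : Fin M → ℕ) where
  cost : Fin I → BlockVec nx → ℝ
  feasible : ∀ i, Set (Vec (nx i))
  A : ∀ (m : Fin M) (i : Fin I), Vec (nx i) →L[ℝ] Vec (nlam m)
  a : ∀ (m : Fin M) (_ : Fin I), Vec (nlam m)

namespace GeneralizedGame

variable {I M : ℕ} {nx : Fin I → ℕ} {nlam : Fin M → ℕ} (G : GeneralizedGame nx nlam)

/-- `Ω = ∏ Ω_i`. -/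
def Omega : Set (BlockVec nx) := {x | ∀ i, x i ∈ G.feasible i}

/-- `A x`. -/
def couplingMap (x : BlockVec nx) : BlockVec nlam :=
  WithLp.toLp 2 (fun m => ∑ i, G.A m i (x i))

/-- `a`. -/
def couplingVec : BlockVec nlam :=
  WithLp.toLp 2 (fun m => ∑ i, G.a m i)

/-- `Aᵀ λ`. -/
def couplingTranspose (lam : BlockVec nlam) : BlockVec nx :=
  WithLp.toLp 2 (fun i => ∑ m, (ContinuousLinearMap.adjoint (G.A m i)) (lam m))

/-- `𝒳 = Ω ∩ {x | A x = a}`. -/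
def feasibleSet : Set (BlockVec nx) := G.Omega ∩ {x | G.couplingMap x = G.couplingVec}

/-- `∇_{x_i} f_i(x_i, x_{-i})`. -/
def partialGrad (i : Fin I) (x : BlockVec nx) : Vec (nx i) :=
  gradient (fun y => G.cost i (replaceBlock x i y)) (x i)

/-- The pseudo-gradient `F(x) = col(∇_{x_i} f_i(x_i, x_{-i}))`. -/
def pseudoGrad (x : BlockVec nx) : BlockVec nx :=
  WithLp.toLp 2 (fun i => G.partialGrad i x)

/-- Generalized Nash equilibria. -/
def IsGNE (x : BlockVec nx) : Prop :=
  x ∈ G.feasibleSet ∧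
    ∀ i, ∀ y : Vec (nx i), replaceBlock x i y ∈ G.feasibleSet →
      G.cost i x ≤ G.cost i (replaceBlock x i y)

/-- Variational GNEs: GNEs at which the optimality conditions of all the agents' problems hold
with one and the same dual variable for the coupling constraints. -/
def IsVGNE (x : BlockVec nx) : Prop :=
  G.IsGNE x ∧
    ∃ lam : BlockVec nlam, ∀ i, ∃ v ∈ normalCone (G.feasible i) (x i),
      G.partialGrad i x + v + ∑ m, (ContinuousLinearMap.adjoint (G.A m i)) (lam m) = 0

/-- The KKT conditions `0 ∈ F(x) + N_Ω(x) + Aᵀ λ`, `0 = A x - a`. -/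
def IsKKT (x : BlockVec nx) (lam : BlockVec nlam) : Prop :=
  (∃ v ∈ normalCone G.Omega x, G.pseudoGrad x + v + G.couplingTranspose lam = 0) ∧
    G.couplingMap x - G.couplingVec = 0

/-- The standing convexity and regularity assumption on the game. The last clause is Slater's
condition for equality constraints: some point of the relative interior of `Ω` satisfies them. -/
structure ConvexRegular : Prop where
  closed : ∀ i, IsClosed (G.feasible i)
  convex : ∀ i, Convex ℝ (G.feasible i)
  cost_continuous : ∀ i, Continuous (G.cost i)
  cost_convex : ∀ i x, ConvexOn ℝ Set.univ (fun y => G.cost i (replaceBlock x i y))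
  cost_differentiable : ∀ i x, Differentiable ℝ (fun y => G.cost i (replaceBlock x i y))
  nonempty : G.feasibleSet.Nonempty
  slater : ∃ x ∈ intrinsicInterior ℝ G.Omega, G.couplingMap x = G.couplingVec

/-- The pseudo-gradient is `μ`-strongly monotone and `θ`-Lipschitz continuous. -/
def StronglyMonotoneLipschitz (μ θ : ℝ) : Prop :=
  (∀ x y, μ * ‖x - y‖ ^ 2 ≤ inner ℝ (G.pseudoGrad x - G.pseudoGrad y) (x - y)) ∧
    ∀ x y, ‖G.pseudoGrad x - G.pseudoGrad y‖ ≤ θ * ‖x - y‖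

end GeneralizedGame

/-! ### Partially coupled aggregative games -/

/-- A generalized aggregative game: `f_i(x) = f̄_i(x_i, (σ_q(x))_q)` with `q` ranging over the
neighbors of `i` in the interference graph `interfSig`, affine aggregation
`σ_q(x) = ∑_i (B_{q,i} x_i + b_{q,i})`, and affine coupling constraints, with `interfLam` and
`interfSig` (edges `(m, i)` and `(q, i)`) describing which local data may be nonzero. -/
structure AggregativeGame {I M Q : ℕ} (nx : Fin I → ℕ) (nlam : Fin M → ℕ) (nsig : Fin Q → ℕ) where
  interfLam : Finset (Fin M × Fin I)
  interfSig : Finset (Fin Q × Fin I)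
  feasible : ∀ i, Set (Vec (nx i))
  A : ∀ (m : Fin M) (i : Fin I), Vec (nx i) →L[ℝ] Vec (nlam m)
  a : ∀ (m : Fin M) (_ : Fin I), Vec (nlam m)
  B : ∀ (q : Fin Q) (i : Fin I), Vec (nx i) →L[ℝ] Vec (nsig q)
  b : ∀ (q : Fin Q) (_ : Fin I), Vec (nsig q)
  fbar : ∀ i, Vec (nx i) → NeighborVec nsig interfSig i → ℝ
  A_eq_zero : ∀ m i, (m, i) ∉ interfLam → A m i = 0
  a_eq_zero : ∀ m i, (m, i) ∉ interfLam → a m i = 0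
  B_eq_zero : ∀ q i, (q, i) ∉ interfSig → B q i = 0
  b_eq_zero : ∀ q i, (q, i) ∉ interfSig → b q i = 0

namespace AggregativeGame

variable {I M Q : ℕ} {nx : Fin I → ℕ} {nlam : Fin M → ℕ} {nsig : Fin Q → ℕ}
  (G : AggregativeGame nx nlam nsig)

/-- The aggregation `σ(x) = B x + b`. -/
def aggregation (x : BlockVec nx) : BlockVec nsig :=
  WithLp.toLp 2 (fun q => ∑ i, (G.B q i (x i) + G.b q i))

/-- The generalized game with costs `f_i(x) = f̄_i(x_i, (σ_q(x))_q)`. -/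
def toGame : GeneralizedGame nx nlam where
  cost i x := G.fbar i (x i) (WithLp.toLp 2 (fun q => G.aggregation x q.1))
  feasible := G.feasible
  A := G.A
  a := G.a

end AggregativeGame

/-! ### Estimate network design -/

/-- An estimate assignment and weighted design graphs for a variable with `P` blocks, over the
communication graph `comm` (`comm j i`: there is an edge from `j` to `i`) and consistent with the
interference graph `interf`. The vertices of the `p`-th design graph are the agents `i` with
`(p, i) ∈ est`, and `edge p j i` says that `(j, i)` is an edge of it. -/
structure EstimateDesign {I P : ℕ} (comm : Fin I → Fin I → Prop)
    (interf : Finset (Fin P × Fin I)) where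
  est : Finset (Fin P × Fin I)
  edge : ∀ p, {i : Fin I // (p, i) ∈ est} → {i : Fin I // (p, i) ∈ est} → Prop
  weight : ∀ p, Matrix {i : Fin I // (p, i) ∈ est} {i : Fin I // (p, i) ∈ est} ℝ
  interf_subset : interf ⊆ est
  edge_comm : ∀ p j i, edge p j i → comm j.1 i.1
  weight_pos : ∀ p j i, edge p j i → 0 < weight p i j
  weight_eq_zero : ∀ p j i, ¬ edge p j i → weight p i j = 0

namespace EstimateDesign

variable {I P : ℕ} {comm : Fin I → Fin I → Prop} {interf : Finset (Fin P × Fin I)}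
  (D : EstimateDesign comm interf)

/-- The agents that keep an estimate of the `p`-th block. -/
abbrev Holder (p : Fin P) : Type := {i : Fin I // (p, i) ∈ D.est}

/-- The number `N_p` of copies of the `p`-th block. -/
def copies (p : Fin P) : ℕ := Fintype.card (D.Holder p)

/-- Stacked estimates `𝐲 = col((𝐲_p)_p)`, `𝐲_p = col((𝐲_{i,p})_i)`, with the Euclidean norm;
`𝐲_{i,p}` is written `y p i`. -/
abbrev Est (n : Fin P → ℕ) : Type :=
  PiLp 2 (fun p : Fin P => PiLp 2 (fun _ : D.Holder p => Vec (n p)))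

/-- All the estimates `𝐲̃_i = col((𝐲_{i,p})_p)` kept by agent `i`. -/
def agentEst {n : Fin P → ℕ} (y : D.Est n) (i : Fin I) : NeighborVec n D.est i :=
  WithLp.toLp 2 (fun p => y p.1 ⟨i, p.2⟩)

/-- The estimates of the blocks that agent `i` needs, extracted from all its estimates. -/
def restrict {n : Fin P → ℕ} (i : Fin I) (y : NeighborVec n D.est i) : NeighborVec n interf i :=
  WithLp.toLp 2 (fun p => y ⟨p.1, D.interf_subset p.2⟩)

/-- The consensus vector `𝓔(y)`, where every copy of `y_p` equals `y_p`. -/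
def consensus {n : Fin P → ℕ} (y : BlockVec n) : D.Est n :=
  WithLp.toLp 2 (fun p => WithLp.toLp 2 (fun _ => y p))

/-- The Laplacian (in-degree matrix minus weight matrix) of the `p`-th design graph. -/
def laplacian (p : Fin P) : Matrix (D.Holder p) (D.Holder p) ℝ :=
  Matrix.diagonal (fun i => ∑ j, D.weight p i j) - D.weight p

/-- The stacked Laplacian `diag((L_p ⊗ I_{n_p})_p)`. -/
def lap {n : Fin P → ℕ} (y : D.Est n) : D.Est n :=
  WithLp.toLp 2 (fun p => WithLp.toLp 2 (fun i => ∑ j, D.laplacian p i j • y p j))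

/-- Every design graph has a directed path from each vertex to each vertex. -/
def StronglyConnected : Prop := ∀ p, ∀ i j : D.Holder p, Relation.ReflTransGen (D.edge p) i j

def Undirected : Prop := ∀ p, ∀ i j : D.Holder p, D.edge p i j → D.edge p j i

def SymmetricWeights : Prop := ∀ p, (D.weight p).IsSymm

/-- Every vertex has equal weighted in-degree and out-degree. -/
def BalancedWeights : Prop :=
  ∀ p, ∀ i : D.Holder p, ∑ j, D.weight p i j = ∑ j, D.weight p j i

end EstimateDesign

/-! ### The primal-dual iteration -/

namespace AggregativeGame

variable {I M Q : ℕ} {nx : Fin I → ℕ} {nlam : Fin M → ℕ} {nsig : Fin Q → ℕ}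
  (G : AggregativeGame nx nlam nsig) {comm : Fin I → Fin I → Prop}
  (DL : EstimateDesign comm G.interfLam) (DS : EstimateDesign comm G.interfSig)

/-- `f̄_i(x_i, 𝛔̃_i)`, as a function of all the estimates kept by agent `i`. -/
def localCost (i : Fin I) (xi : Vec (nx i)) (s : NeighborVec nsig DS.est i) : ℝ :=
  G.fbar i xi (DS.restrict i s)

/-- The extended pseudo-gradient
`col(∇_{x_i} f̄_i(x_i, 𝛔̃_i) + B̃_iᵀ ∇_{𝛔̃_i} f̄_i(x_i, 𝛔̃_i))`. -/
def extPseudoGrad (x : BlockVec nx) (s : DS.Est nsig) : BlockVec nx :=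
  WithLp.toLp 2 (fun i =>
    gradient (fun y => G.localCost DS i y (DS.agentEst s i)) (x i) +
      ∑ q : {q : Fin Q // (q, i) ∈ DS.est}, (ContinuousLinearMap.adjoint (G.B q.1 i))
        ((gradient (fun t => G.localCost DS i (x i) t) (DS.agentEst s i)) q))

/-- `𝐀 x`: the entry of agent `i` for block `m` is `A_{m,i} x_i`. -/
def stackedA (x : BlockVec nx) : DL.Est nlam :=
  WithLp.toLp 2 (fun m => WithLp.toLp 2 (fun i => G.A m i.1 (x i.1)))

/-- `𝐚`. -/
def stackeda : DL.Est nlam :=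
  WithLp.toLp 2 (fun m => WithLp.toLp 2 (fun i => G.a m i.1))

/-- `𝐀ᵀ 𝛌`. -/
def stackedATranspose (l : DL.Est nlam) : BlockVec nx :=
  WithLp.toLp 2 (fun i => ∑ m : {m : Fin M // (m, i) ∈ DL.est},
    (ContinuousLinearMap.adjoint (G.A m.1 i)) (l m.1 ⟨i, m.2⟩))

/-- `𝐁 x`: the entry of agent `i` for block `q` is `N_q B_{q,i} x_i`. -/
def stackedB (x : BlockVec nx) : DS.Est nsig :=
  WithLp.toLp 2 (fun q => WithLp.toLp 2 (fun i => (DS.copies q : ℝ) • G.B q i.1 (x i.1)))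

/-- `𝐛`. -/
def stackedb : DS.Est nsig :=
  WithLp.toLp 2 (fun q => WithLp.toLp 2 (fun i => (DS.copies q : ℝ) • G.b q i.1))

/-- `𝐁ᵀ 𝐬`. -/
def stackedBTranspose (s : DS.Est nsig) : BlockVec nx :=
  WithLp.toLp 2 (fun i => ∑ q : {q : Fin Q // (q, i) ∈ DS.est},
    (DS.copies q.1 : ℝ) • (ContinuousLinearMap.adjoint (G.B q.1 i)) (s q.1 ⟨i, q.2⟩))

/-- The state `(x, 𝛔, 𝐳, 𝛌)` of the iteration. -/
abbrev IterState : Type := BlockVec nx × DS.Est nsig × DL.Est nlam × DL.Est nlam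

/-- One step of the primal-dual iteration with step sizes `α`, `β`. -/
def step (α β : ℝ) : G.IterState DL DS → G.IterState DL DS := fun (x, s, z, l) =>
  let x' := metricProj G.toGame.Omega
    (x - β • (α • G.extPseudoGrad DS x s + G.stackedBTranspose DS (DS.lap s)
      + G.stackedATranspose DL l))
  let s' := s - β • DS.lap s + G.stackedB DS (x' - x)
  let z' := z + β • DL.lap l
  let l' := l - β • (DL.lap ((2 : ℝ) • z' - z) - G.stackedA DL ((2 : ℝ) • x' - x)
    + G.stackeda DL)
  (x', s', z', l')

/-- The initial state: `x⁰`, `𝐳⁰`, `𝛌⁰` are arbitrary and `𝛔⁰ = 𝐁 x⁰ + 𝐛`. -/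
def initState (x0 : BlockVec nx) (z0 l0 : DL.Est nlam) : G.IterState DL DS :=
  (x0, G.stackedB DS x0 + G.stackedb DS, z0, l0)

/-- The sequence generated by the iteration. -/
def iter (α β : ℝ) (x0 : BlockVec nx) (z0 l0 : DL.Est nlam) (k : ℕ) : G.IterState DL DS :=
  (G.step DL DS α β)^[k] (G.initState DL DS x0 z0 l0)

/-- The extended pseudo-gradient is `θ`-Lipschitz in `(x, 𝛔)`, in the Euclidean norm. -/
def ExtLipschitz (θ : ℝ) : Prop :=
  ∀ x x' : BlockVec nx, ∀ s s' : DS.Est nsig,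
    ‖G.extPseudoGrad DS x s - G.extPseudoGrad DS x' s'‖ ≤
      θ * √(‖x - x'‖ ^ 2 + ‖s - s'‖ ^ 2)

end AggregativeGame

end

/-! In the variables `(x, σ - 𝐁 x, z, λ)` the iteration is a preconditioned forward-backward
splitting, and the preconditioner defines the quadratic form `primalDualEnergy`, positive definite
for small `β`. The couplings through `𝐀` and the dual Laplacian are skew; the extrapolations `2x' -
x` and `2z' - z` make them cancel exactly in the energy balance (`primalDualEnergy_step`). Only the
pairing of the forward terms with the new iterate survives.

The extended pseudo-gradient need not be monotone, but the iteration stays in a set where the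
forward operator is strongly monotone towards solutions. Balanced weights and `σ⁰ = 𝐁 x⁰ + 𝐛` keep
the tracking error `u = σ - 𝓔(σ(x))` orthogonal to the consensus space (`TrackingData.step_mem`),
and there the Laplacian of strongly connected balanced graphs is coercive with some constant `c`.
The Lipschitz error `αθ‖u‖‖x - x⋆‖` is then dominated by `αμ‖x - x⋆‖² + c‖u‖²` once `α < μc/θ²`
(`TrackingData.forward_inner_ge`). The forward step uses the old iterate; the loss is of order `β`
times the squared increment, which the energy of the increment absorbs for small `β`. Hence the
energy distance to every fixed point decreases (`TrackingData.energy_decrease`), and a Fejér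
argument gives convergence (`tendsto_iterate_of_fejer`).

Fixed points are KKT points: the dual Laplacian has the consensus vectors as kernel and their
orthogonal complement as range, so `λ` agrees across agents, and `z` exists precisely because the
rows of `𝐀 x - 𝐚` sum to zero. A KKT point exists by solving a strongly monotone variational
inequality on the feasible set and extracting a multiplier under Slater's condition
(`exists_multiplier`). Strong monotonicity also makes its primal part unique. -/

noncomputable section

/-! ### Metric projections -/

section Projection

theorem metricProj_mem {E : Type*} [NormedAddCommGroup E] [ProperSpace E] {K : Set E}
    (hK : IsClosed K) (hne : K.Nonempty) (u : E) : metricProj K u ∈ K :=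
  (isMetricProj_metricProj hK hne u).1

variable {E : Type*} [NormedAddCommGroup E] [InnerProductSpace ℝ E]

theorem IsMetricProj.inner_le_zero {K : Set E} (hK : Convex ℝ K) {u v : E}
    (h : IsMetricProj K u v) {w : E} (hw : w ∈ K) : inner ℝ (u - v) (w - v) ≤ 0 := by
  refine (norm_eq_iInf_iff_real_inner_le_zero hK h.1).1 ?_ w hw
  have : Nonempty K := ⟨⟨v, h.1⟩⟩
  refine le_antisymm (le_ciInf fun w => h.2 w w.2) ?_
  exact ciInf_le (f := fun w : K => ‖u - w‖)
    ⟨0, by rintro _ ⟨w, rfl⟩; exact norm_nonneg _⟩ ⟨v, h.1⟩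

/-- Adding the two obtuse-angle inequalities gives firm nonexpansiveness `‖v - v'‖² ≤ ⟪u - u', v -
v'⟫`; Cauchy-Schwarz finishes. The case `u = u'` is uniqueness of the projection. -/
theorem norm_sub_le_of_obtuse {u u' v v' : E} (h : inner ℝ (u - v) (v' - v) ≤ 0)
    (h' : inner ℝ (u' - v') (v - v') ≤ 0) : ‖v - v'‖ ≤ ‖u - u'‖ := by
  have key : ‖v - v'‖ ^ 2 ≤ inner ℝ (u - u') (v - v') := by
    rw [← real_inner_self_eq_norm_sq]
    simp only [inner_sub_left, inner_sub_right] at *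
    linarith
  have cs := real_inner_le_norm (u - u') (v - v')
  rcases (norm_nonneg (v - v')).eq_or_lt with h0 | h0
  · rw [← h0]; exact norm_nonneg _
  · nlinarith

variable [ProperSpace E] {K : Set E}

theorem inner_metricProj_le_zero (hK : IsClosed K) (hc : Convex ℝ K) (hne : K.Nonempty) (u : E)
    {w : E} (hw : w ∈ K) : inner ℝ (u - metricProj K u) (w - metricProj K u) ≤ 0 :=
  (isMetricProj_metricProj hK hne u).inner_le_zero hc hw

theorem norm_metricProj_sub_le (hK : IsClosed K) (hc : Convex ℝ K) (hne : K.Nonempty) (u u' : E) :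
    ‖metricProj K u - metricProj K u'‖ ≤ ‖u - u'‖ :=
  norm_sub_le_of_obtuse
    (inner_metricProj_le_zero hK hc hne u (metricProj_mem hK hne u'))
    (inner_metricProj_le_zero hK hc hne u' (metricProj_mem hK hne u))

theorem continuous_metricProj (hK : IsClosed K) (hc : Convex ℝ K) (hne : K.Nonempty) :
    Continuous (metricProj K) := by
  refine LipschitzWith.continuous (K := 1) (LipschitzWith.of_dist_le_mul fun u v => ?_)
  simpa [dist_eq_norm] using norm_metricProj_sub_le hK hc hne u v

theorem metricProj_eq_of_inner_le_zero (hK : IsClosed K) (hc : Convex ℝ K) {u v : E} (hv : v ∈ K)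
    (h : ∀ w ∈ K, inner ℝ (u - v) (w - v) ≤ 0) : metricProj K u = v := by
  have := norm_sub_le_of_obtuse (inner_metricProj_le_zero hK hc ⟨v, hv⟩ u hv)
    (h _ (metricProj_mem hK ⟨v, hv⟩ u))
  rw [sub_self, norm_zero] at this
  exact sub_eq_zero.1 (norm_le_zero_iff.1 this)

/-- A strongly monotone Lipschitz variational inequality has a solution. -/
theorem exists_variational_solution (hK : IsClosed K) (hc : Convex ℝ K) (hne : K.Nonempty)
    {F : E → E} {μ θ : ℝ} (hμ : 0 < μ) (hθ : 0 < θ)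
    (hmon : ∀ x y, μ * ‖x - y‖ ^ 2 ≤ inner ℝ (F x - F y) (x - y))
    (hlip : ∀ x y, ‖F x - F y‖ ≤ θ * ‖x - y‖) :
    ∃ x ∈ K, ∀ y ∈ K, 0 ≤ inner ℝ (F x) (y - x) := by
  -- The step `γ = μ / θ²` minimizes `1 - 2γμ + γ²θ²`, the bound on the squared contraction factor
  -- of `x ↦ x - γ F x`.
  have hγ : 0 < μ / θ ^ 2 := by positivity
  set γ := μ / θ ^ 2
  set r : NNReal := (√(1 - μ ^ 2 / θ ^ 2)).toNNReal with hr
  have hrr : (r : ℝ) = √(1 - μ ^ 2 / θ ^ 2) := Real.coe_toNNReal _ (Real.sqrt_nonneg _)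
  have hcon : ContractingWith r (fun x => metricProj K (x - γ • F x)) := by
    refine ⟨?_, LipschitzWith.of_dist_le_mul fun x y => ?_⟩
    · rw [← NNReal.coe_lt_coe, hrr, NNReal.coe_one, Real.sqrt_lt' one_pos]
      have : 0 < μ ^ 2 / θ ^ 2 := by positivity
      linarith
    · rw [dist_eq_norm, dist_eq_norm]
      refine (norm_metricProj_sub_le hK hc hne _ _).trans ?_
      rw [hrr, ← Real.sqrt_sq (norm_nonneg (x - y)), ← Real.sqrt_mul' _ (sq_nonneg _)]
      apply Real.le_sqrt_of_sq_le
      have e : x - γ • F x - (y - γ • F y) = (x - y) - γ • (F x - F y) := by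
        rw [smul_sub]; abel
      rw [e, norm_sub_sq_real, norm_smul, Real.norm_of_nonneg hγ.le, inner_smul_right,
        real_inner_comm]
      have h2 : ‖F x - F y‖ ^ 2 ≤ θ ^ 2 * ‖x - y‖ ^ 2 := by
        rw [← mul_pow]; exact pow_le_pow_left₀ (norm_nonneg _) (hlip x y) 2
      have h3 := mul_le_mul_of_nonneg_left h2 (sq_nonneg γ)
      have h4 := mul_le_mul_of_nonneg_left (hmon x y) hγ.le
      have e1 : γ * μ = μ ^ 2 / θ ^ 2 := by simp only [γ]; field_simp
      have e2 : γ ^ 2 * θ ^ 2 = μ ^ 2 / θ ^ 2 := by simp only [γ]; field_simp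
      rw [← mul_assoc, e2] at h3
      rw [← mul_assoc, e1] at h4
      nlinarith
  obtain ⟨x, hx⟩ : ∃ x, metricProj K (x - γ • F x) = x :=
    ⟨_, ContractingWith.fixedPoint_isFixedPt hcon⟩
  refine ⟨x, hx ▸ metricProj_mem hK hne _, fun y hy => ?_⟩
  have h := inner_metricProj_le_zero hK hc hne (x - γ • F x) hy
  rw [hx, sub_sub_cancel_left, inner_neg_left, inner_smul_left] at h
  simp only [conj_trivial] at h
  nlinarith

end Projection

/-! ### Fejér monotone fixed-point iterations -/

/-- The energy to a fixed point decreases and is bounded below, so residuals vanish and the orbit is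
bounded. By continuity any cluster point `q` is fixed. The energy to `q` is monotone and tends to
`0` along a subsequence, hence along the whole orbit. -/
theorem tendsto_iterate_of_fejer {E : Type*} [NormedAddCommGroup E] [ProperSpace E] {T : E → E}
    (hT : Continuous T) {Adm : Set E} (hclosed : IsClosed Adm) (hinv : ∀ w ∈ Adm, T w ∈ Adm)
    {D : E → E → ℝ} (hDcont : ∀ p, Continuous fun w => D w p) (hDself : ∀ p, D p p = 0)
    {c : ℝ} (hc : 0 < c) (hD : ∀ w p, c * ‖w - p‖ ^ 2 ≤ D w p)
    (hdec : ∀ p ∈ Adm, T p = p → ∀ w ∈ Adm, D (T w) p + c * ‖w - T w‖ ^ 2 ≤ D w p)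
    (hex : ∃ p ∈ Adm, T p = p) {w : E} (hw : w ∈ Adm) :
    ∃ p ∈ Adm, T p = p ∧ Tendsto (fun k => T^[k] w) atTop (𝓝 p) := by
  set u : ℕ → E := fun k => T^[k] w with hu
  have hsucc : ∀ k, u (k + 1) = T (u k) := fun k => Function.iterate_succ_apply' T k w
  have hadm : ∀ k, u k ∈ Adm := by
    intro k
    induction k with
    | zero => exact hw
    | succ k ih => rw [hsucc]; exact hinv _ ih
  have hanti : ∀ p ∈ Adm, T p = p → Antitone fun k => D (u k) p := by
    intro p hp hfix
    refine antitone_nat_of_succ_le fun k => ?_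
    rw [hsucc]
    have := hdec p hp hfix (u k) (hadm k)
    have : 0 ≤ c * ‖u k - T (u k)‖ ^ 2 := by positivity
    linarith
  have hDnn : ∀ w p, 0 ≤ D w p := fun w p => (by positivity : 0 ≤ c * ‖w - p‖ ^ 2).trans (hD w p)
  have hnorm : ∀ {f : ℕ → E}, Tendsto (fun k => c * ‖f k‖ ^ 2) atTop (𝓝 0) →
      Tendsto f atTop (𝓝 0) := by
    intro f hf
    rw [tendsto_zero_iff_norm_tendsto_zero]
    have h1 := (hf.const_mul c⁻¹)
    simp only [inv_mul_cancel_left₀ hc.ne', mul_zero] at h1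
    have h2 := (Real.continuous_sqrt.tendsto 0).comp h1
    simpa [Function.comp_def, Real.sqrt_sq (norm_nonneg _)] using h2
  obtain ⟨p, hp, hfix⟩ := hex
  obtain ⟨l, hl⟩ : ∃ l, Tendsto (fun k => D (u k) p) atTop (𝓝 l) :=
    ⟨_, tendsto_atTop_ciInf (hanti p hp hfix) ⟨0, by rintro _ ⟨k, rfl⟩; exact hDnn _ _⟩⟩
  have hres : Tendsto (fun k => u k - T (u k)) atTop (𝓝 0) := by
    apply hnorm
    have h1 := hl.sub (hl.comp (tendsto_add_atTop_nat 1))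
    rw [sub_self] at h1
    refine squeeze_zero (fun k => by positivity) (fun k => ?_) h1
    have := hdec p hp hfix (u k) (hadm k)
    simp only [Function.comp_apply, hsucc]
    linarith
  have hbdd : Bornology.IsBounded (Set.range u) := by
    rw [isBounded_iff_forall_norm_le]
    refine ⟨‖p‖ + √(c⁻¹ * D w p), ?_⟩
    rintro _ ⟨k, rfl⟩
    have h1 := (hD (u k) p).trans (hanti p hp hfix (Nat.zero_le k))
    have h2 : ‖u k - p‖ ≤ √(c⁻¹ * D w p) := by
      apply Real.le_sqrt_of_sq_le
      rw [inv_mul_eq_div, le_div_iff₀ hc, mul_comm]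
      exact h1
    calc ‖u k‖ = ‖p + (u k - p)‖ := by rw [add_sub_cancel]
      _ ≤ ‖p‖ + ‖u k - p‖ := norm_add_le _ _
      _ ≤ _ := by gcongr
  obtain ⟨q, -, φ, hφ, hq⟩ := tendsto_subseq_of_bounded hbdd fun k => Set.mem_range_self k
  have hqadm : q ∈ Adm := hclosed.mem_of_tendsto hq (Eventually.of_forall fun k => hadm _)
  have hqfix : T q = q := by
    have h1 := hq.sub ((hT.tendsto q).comp hq)
    exact (sub_eq_zero.1 (tendsto_nhds_unique h1 (hres.comp hφ.tendsto_atTop))).symm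
  refine ⟨q, hqadm, hqfix, ?_⟩
  have hsub : Tendsto (fun k => D (u (φ k)) q) atTop (𝓝 0) := by
    have := ((hDcont q).tendsto q).comp hq
    rwa [hDself] at this
  have hfull : Tendsto (fun k => D (u k) q) atTop (𝓝 0) := by
    have h1 := tendsto_atTop_ciInf (hanti q hqadm hqfix)
      ⟨0, by rintro _ ⟨k, rfl⟩; exact hDnn _ _⟩
    rwa [tendsto_nhds_unique (h1.comp hφ.tendsto_atTop) hsub] at h1
  rw [← tendsto_sub_nhds_zero_iff]
  exact hnorm (squeeze_zero (fun k => by positivity) (fun k => hD _ _) hfull)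

/-! ### Lagrange multipliers under Slater's condition -/

theorem exists_ball_subset_of_mem_intrinsicInterior {X : Type*} [NormedAddCommGroup X]
    [NormedSpace ℝ X] {Ω : Set X} {x₀ : X} (h : x₀ ∈ intrinsicInterior ℝ Ω) :
    ∃ ε > 0, ∀ v ∈ (affineSpan ℝ Ω).direction, ‖v‖ < ε → x₀ + v ∈ Ω := by
  obtain ⟨y, hy, rfl⟩ := mem_intrinsicInterior.1 h
  obtain ⟨ε, hε, hball⟩ := Metric.mem_nhds_iff.1 (mem_interior_iff_mem_nhds.1 hy)
  refine ⟨ε, hε, fun v hv hvε => ?_⟩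
  have hmem : (y : X) + v ∈ affineSpan ℝ Ω := by
    have := AffineSubspace.vadd_mem_of_mem_direction hv y.2
    rwa [vadd_eq_add, add_comm] at this
  have : (⟨(y : X) + v, hmem⟩ : affineSpan ℝ Ω) ∈ Metric.ball y ε := by
    rw [Metric.mem_ball, Subtype.dist_eq, dist_eq_norm]
    simpa using hvε
  exact hball this

/-- A linear functional that is minimized over `Ω ∩ {y | A y = A x}` at `x` is, after adding a
multiplier of the constraint, minimized over `Ω` at `x`. -/
theorem exists_multiplier {X Y : Type*} [NormedAddCommGroup X] [InnerProductSpace ℝ X]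
    [NormedAddCommGroup Y] [InnerProductSpace ℝ Y] [FiniteDimensional ℝ Y]
    (A : X →ₗ[ℝ] Y) {Ω : Set X} (hΩ : Convex ℝ Ω) {x₀ x : X} (hx₀ : x₀ ∈ intrinsicInterior ℝ Ω)
    (hA : A x₀ = A x) {g : X}
    (hg : ∀ y ∈ Ω, A y = A x → 0 ≤ inner ℝ g (y - x)) :
    ∃ l : Y, ∀ y ∈ Ω, 0 ≤ inner ℝ g (y - x) + inner ℝ l (A (y - x)) := by
  obtain ⟨ε, hε, hball⟩ := exists_ball_subset_of_mem_intrinsicInterior hx₀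
  set V := (affineSpan ℝ Ω).direction
  have hx₀Ω : x₀ ∈ Ω := intrinsicInterior_subset hx₀
  -- The cone over `Ω - x₀` at height one, with the apex added. Working in the direction `V` of the
  -- affine span lets a relative interior point play the role of an interior point.
  let K : ConvexCone ℝ (V × ℝ) :=
    { carrier := {p | p = 0 ∨ 0 < p.2 ∧ x₀ + p.2⁻¹ • (p.1 : X) ∈ Ω}
      smul_mem' := by
        rintro c hc ⟨v, t⟩ (h0 | ⟨ht, hv⟩)
        · exact Or.inl (by rw [h0, smul_zero])
        refine Or.inr ⟨mul_pos hc ht, ?_⟩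
        simp only [Prod.smul_mk, smul_eq_mul, Submodule.coe_smul, smul_smul] at hv ⊢
        rwa [mul_inv, mul_comm c⁻¹, mul_assoc, inv_mul_cancel₀ hc.ne', mul_one]
      add_mem' := by
        rintro ⟨v, t⟩ (h0 | ⟨ht, hv⟩) ⟨v', t'⟩ h'
        · rwa [h0, zero_add]
        rcases h' with h0 | ⟨ht', hv'⟩
        · rw [h0, add_zero]
          exact Or.inr ⟨ht, hv⟩
        simp only at ht hv ht' hv'
        have hs : 0 < t + t' := add_pos ht ht'
        refine Or.inr ⟨hs, ?_⟩
        have := hΩ hv hv' (a := t / (t + t')) (b := t' / (t + t')) (by positivity) (by positivity)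
          (by field_simp)
        convert this using 1
        simp only [Prod.mk_add_mk, Submodule.coe_add, smul_add, smul_smul]
        have e1 : t / (t + t') * t⁻¹ = (t + t')⁻¹ := by field_simp
        have e2 : t' / (t + t') * t'⁻¹ = (t + t')⁻¹ := by field_simp
        rw [e1, e2]
        have e3 : x₀ = (t / (t + t')) • x₀ + (t' / (t + t')) • x₀ := by
          rw [← add_smul, ← add_div, div_self hs.ne', one_smul]
        nth_rewrite 1 [e3]
        abel }
  let AV : V →ₗ[ℝ] Y := A.comp V.subtype
  let gV : V →ₗ[ℝ] ℝ := (innerₗ X g).comp V.subtype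
  -- On `ker A × ℝ` the functional is `t * ⟪g, x₀ + t⁻¹ v - x⟫` for `t > 0`, so it is nonnegative on
  -- the cone by the minimality of `x`. The M. Riesz theorem extends it to all of `V × ℝ`.
  let f : (V × ℝ) →ₗ.[ℝ] ℝ :=
    { domain := (LinearMap.ker AV).prod ⊤
      toFun := ((gV.comp (LinearMap.fst ℝ V ℝ)) +
        (inner ℝ g (x₀ - x)) • (LinearMap.snd ℝ V ℝ)).comp (Submodule.subtype _) }
  obtain ⟨G, hGf, hGK⟩ := riesz_extension (K.toPointedCone (Or.inl rfl)) f
    (by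
      rintro ⟨⟨v, t⟩, hv⟩ (h0 | ⟨ht, hmem⟩)
      · rw [show (⟨(v, t), hv⟩ : f.domain) = 0 from Subtype.ext h0]
        exact f.map_zero.ge
      simp only at ht hmem
      have hv0 : A (v : X) = 0 := (Submodule.mem_prod.1 hv).1
      have := hg _ hmem (by rw [map_add, map_smul, hv0, smul_zero, add_zero, hA])
      change 0 ≤ inner ℝ g (v : X) + inner ℝ g (x₀ - x) * t
      have e : x₀ + t⁻¹ • (v : X) - x = (x₀ - x) + t⁻¹ • (v : X) := by abel
      rw [e, inner_add_right, inner_smul_right] at this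
      have h2 := mul_nonneg ht.le this
      rw [mul_add, mul_inv_cancel_left₀ ht.ne'] at h2
      linarith)
    (by
      -- Slater's condition enters here: raising the height to `R = (‖v‖ + 1) / ε` puts `R⁻¹ v`
      -- within `ε` of the origin, hence `(v, R)` in the cone.
      rintro ⟨v, t⟩
      set R : ℝ := (‖v‖ + 1) / ε with hR
      have hRpos : 0 < R := by positivity
      refine ⟨⟨(0, R - t), Submodule.mem_prod.2 ⟨by simp, trivial⟩⟩, Or.inr ⟨?_, ?_⟩⟩
      · simpa using hRpos
      · simp only [Prod.mk_add_mk, zero_add, sub_add_cancel]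
        refine hball _ (V.smul_mem _ v.2) ?_
        rw [norm_smul, norm_inv, Real.norm_of_nonneg hRpos.le, inv_mul_lt_iff₀ hRpos, hR,
          div_mul_cancel₀ _ hε.ne']
        simp)
  -- The extension differs from `g` by a functional vanishing on `ker A`, which therefore factors
  -- through `A`; the factor is the multiplier.
  let H : V →ₗ[ℝ] ℝ := G.comp (LinearMap.inl ℝ V ℝ) - gV
  have hker : LinearMap.ker AV ≤ LinearMap.ker H := by
    intro v hv
    have := hGf ⟨(v, 0), Submodule.mem_prod.2 ⟨hv, trivial⟩⟩
    have e : f ⟨(v, 0), Submodule.mem_prod.2 ⟨hv, trivial⟩⟩ = gV v := by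
      change gV v + inner ℝ g (x₀ - x) * 0 = _
      simp
    rw [LinearMap.mem_ker]
    change G (v, 0) - gV v = 0
    rw [this, e, sub_self]
  obtain ⟨φ, hφ⟩ : H ∈ LinearMap.range AV.dualMap := by
    rw [LinearMap.range_dualMap_eq_dualAnnihilator_ker, Submodule.mem_dualAnnihilator]
    exact fun v hv => hker hv
  obtain ⟨l, hl⟩ := (InnerProductSpace.toDual ℝ Y).surjective (LinearMap.toContinuousLinearMap φ)
  have hlφ : ∀ y, inner ℝ l y = φ y := fun y => by
    rw [← InnerProductSpace.toDual_apply_apply, hl]; rfl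
  refine ⟨l, fun y hy => ?_⟩
  have hyV : y - x₀ ∈ V := AffineSubspace.vsub_mem_direction
    (subset_affineSpan ℝ Ω hy) (subset_affineSpan ℝ Ω hx₀Ω)
  have h1 := hGK (⟨y - x₀, hyV⟩, 1) (Or.inr ⟨one_pos, by simpa using hy⟩)
  have h2 : G (0, 1) = inner ℝ g (x₀ - x) := by
    have := hGf ⟨(0, 1), Submodule.mem_prod.2 ⟨by simp, trivial⟩⟩
    rw [this]
    change gV 0 + inner ℝ g (x₀ - x) * 1 = _
    simp
  have h3 : φ (A (y - x₀)) = G (⟨y - x₀, hyV⟩, 0) - inner ℝ g (y - x₀) := by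
    have := LinearMap.congr_fun hφ ⟨y - x₀, hyV⟩
    exact this
  have h4 : G (⟨y - x₀, hyV⟩, 1) = G (⟨y - x₀, hyV⟩, 0) + G (0, 1) := by
    rw [← map_add]; simp
  have h5 : A (y - x) = A (y - x₀) := by rw [map_sub, map_sub, hA]
  have h6 : inner ℝ g (y - x) = inner ℝ g (y - x₀) + inner ℝ g (x₀ - x) := by
    rw [← inner_add_right]; congr 1; abel
  rw [hlφ, h5, h6, h3]
  linarith

end

noncomputable section

/-! ### The primal-dual iteration in abstract Euclidean spaces -/

section AbstractIteration

variable {X S Y : Type*} [NormedAddCommGroup X] [InnerProductSpace ℝ X] [FiniteDimensional ℝ X]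
  [NormedAddCommGroup S] [InnerProductSpace ℝ S] [FiniteDimensional ℝ S]
  [NormedAddCommGroup Y] [InnerProductSpace ℝ Y] [FiniteDimensional ℝ Y]

open ContinuousLinearMap (adjoint)

/-- One step of the preconditioned forward-backward iteration with dual consensus operator `LL`
and tracking operator `LS`. -/
def primalDualStep (Ω : Set X) (Ft : X → S → X) (B : X →L[ℝ] S) (LS : S →L[ℝ] S) (A : X →L[ℝ] Y)
    (a : Y) (LL : Y →L[ℝ] Y) (α β : ℝ) : X × S × Y × Y → X × S × Y × Y := fun (x, s, z, l) =>
  let x' := metricProj Ω (x - β • (α • Ft x s + adjoint B (LS s) + adjoint A l))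
  let s' := s - β • LS s + B (x' - x)
  let z' := z + β • LL l
  let l' := l - β • (LL ((2 : ℝ) • z' - z) - A ((2 : ℝ) • x' - x) + a)
  (x', s', z', l')

/-- The squared norm in which the primal-dual iteration is Fejér monotone. -/
def primalDualEnergy (B : X →L[ℝ] S) (A : X →L[ℝ] Y) (LL : Y →L[ℝ] Y) (β : ℝ)
    (w : X × S × Y × Y) : ℝ :=
  ‖w.1‖ ^ 2 + ‖w.2.1 - B w.1‖ ^ 2 + ‖w.2.2.1‖ ^ 2 + ‖w.2.2.2‖ ^ 2
    - 2 * β * inner ℝ (A w.1) w.2.2.2 + 2 * β * inner ℝ (LL w.2.2.1) w.2.2.2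

omit [FiniteDimensional ℝ X] [FiniteDimensional ℝ S] [FiniteDimensional ℝ Y] in
-- Young's inequality bounds the cross terms of the preconditioner by half of the diagonal.
theorem half_le_primalDualEnergy (B : X →L[ℝ] S) (A : X →L[ℝ] Y) (LL : Y →L[ℝ] Y) {β : ℝ}
    (hβ : 0 ≤ β) (h : β * (‖A‖ + ‖LL‖) ≤ 1 / 2) (w : X × S × Y × Y) :
    (1 / 2) * (‖w.1‖ ^ 2 + ‖w.2.1 - B w.1‖ ^ 2 + ‖w.2.2.1‖ ^ 2 + ‖w.2.2.2‖ ^ 2) ≤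
      primalDualEnergy B A LL β w := by
  obtain ⟨x, s, z, l⟩ := w
  simp only [primalDualEnergy]
  have h1 : inner ℝ (A x) l ≤ ‖A‖ * ((‖x‖ ^ 2 + ‖l‖ ^ 2) / 2) :=
    calc inner ℝ (A x) l ≤ ‖A x‖ * ‖l‖ := real_inner_le_norm _ _
      _ ≤ ‖A‖ * ‖x‖ * ‖l‖ := by gcongr; exact A.le_opNorm x
      _ = ‖A‖ * (‖x‖ * ‖l‖) := by ring
      _ ≤ _ := by gcongr; nlinarith [sq_nonneg (‖x‖ - ‖l‖)]
  have h2 : -inner ℝ (LL z) l ≤ ‖LL‖ * ((‖z‖ ^ 2 + ‖l‖ ^ 2) / 2) :=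
    calc -inner ℝ (LL z) l ≤ ‖LL z‖ * ‖l‖ := (neg_le_abs _).trans (abs_real_inner_le_norm _ _)
      _ ≤ ‖LL‖ * ‖z‖ * ‖l‖ := by gcongr; exact LL.le_opNorm z
      _ = ‖LL‖ * (‖z‖ * ‖l‖) := by ring
      _ ≤ _ := by gcongr; nlinarith [sq_nonneg (‖z‖ - ‖l‖)]
  have h1' := mul_le_mul_of_nonneg_left h1 hβ
  have h2' := mul_le_mul_of_nonneg_left h2 hβ
  have h3 : β * ‖A‖ * ‖x‖ ^ 2 ≤ 1 / 2 * ‖x‖ ^ 2 := by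
    gcongr; nlinarith [mul_nonneg hβ (norm_nonneg LL)]
  have h4 : β * ‖LL‖ * ‖z‖ ^ 2 ≤ 1 / 2 * ‖z‖ ^ 2 := by
    gcongr; nlinarith [mul_nonneg hβ (norm_nonneg A)]
  have h5 : β * (‖A‖ + ‖LL‖) * ‖l‖ ^ 2 ≤ 1 / 2 * ‖l‖ ^ 2 := by gcongr
  have h6 := sq_nonneg ‖s - B x‖
  linarith

omit [FiniteDimensional ℝ X] [FiniteDimensional ℝ S] [FiniteDimensional ℝ Y]
  [InnerProductSpace ℝ Y] in
-- Passes from the Euclidean quantities of the energy to the max norm of the product; the constant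
-- comes from `s = (s - B x) + B x`.
theorem norm_sq_le_sum_sq (B : X →L[ℝ] S) (w : X × S × Y × Y) :
    ‖w‖ ^ 2 ≤ (2 + 2 * ‖B‖ ^ 2) *
      (‖w.1‖ ^ 2 + ‖w.2.1 - B w.1‖ ^ 2 + ‖w.2.2.1‖ ^ 2 + ‖w.2.2.2‖ ^ 2) := by
  obtain ⟨x, s, z, l⟩ := w
  simp only
  have hs : ‖s‖ ^ 2 ≤ 2 * ‖s - B x‖ ^ 2 + 2 * ‖B‖ ^ 2 * ‖x‖ ^ 2 := by
    have h1 : ‖s‖ ≤ ‖s - B x‖ + ‖B‖ * ‖x‖ :=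
      calc ‖s‖ = ‖(s - B x) + B x‖ := by rw [sub_add_cancel]
        _ ≤ ‖s - B x‖ + ‖B x‖ := norm_add_le _ _
        _ ≤ _ := by gcongr; exact B.le_opNorm x
    have h2 := pow_le_pow_left₀ (norm_nonneg s) h1 2
    nlinarith [sq_nonneg (‖s - B x‖ - ‖B‖ * ‖x‖)]
  have hb : 0 ≤ ‖B‖ ^ 2 := sq_nonneg _
  have e1 := sq_nonneg ‖x‖
  have e2 := sq_nonneg ‖s - B x‖
  have e3 := sq_nonneg ‖z‖
  have e4 := sq_nonneg ‖l‖
  have m1 := mul_nonneg hb e1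
  have m2 := mul_nonneg hb e2
  have m3 := mul_nonneg hb e3
  have m4 := mul_nonneg hb e4
  simp only [Prod.norm_def]
  rcases max_cases ‖x‖ (max ‖s‖ (max ‖z‖ ‖l‖)) with h | h <;> rw [h.1]
  · linarith
  rcases max_cases ‖s‖ (max ‖z‖ ‖l‖) with h | h <;> rw [h.1]
  · linarith
  rcases max_cases ‖z‖ ‖l‖ with h | h <;> rw [h.1] <;> linarith

omit [FiniteDimensional ℝ S] in
/-- The energy balance of one step, with `h` and `v` the forward parts of the updates. -/
theorem primalDualEnergy_step (B : X →L[ℝ] S) (A : X →L[ℝ] Y) (LL : Y →L[ℝ] Y)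
    (hLL : ∀ y y', inner ℝ (LL y) y' = inner ℝ y (LL y')) {β : ℝ}
    {x x' h : X} {s s' v : S} {z z' l l' : Y}
    (hx : 0 ≤ inner ℝ (x - x' - β • (h + adjoint A l)) x')
    (hs : s - s' = β • v + B (x - x'))
    (hz : z' = z + β • LL l) (hl : l - l' = β • (LL ((2 : ℝ) • z' - z) - A ((2 : ℝ) • x' - x))) :
    primalDualEnergy B A LL β (x', s', z', l') +
      primalDualEnergy B A LL β (x - x', s - s', z - z', l - l') +
      2 * β * (inner ℝ h x' + inner ℝ v (s' - B x')) ≤ primalDualEnergy B A LL β (x, s, z, l) := by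
  -- Each increment is paired with its new value, so that `2⟪w - w', w'⟫ = ‖w‖² - ‖w'‖² - ‖w - w'‖²`
  -- holds in the energy form. In the sum all terms with `A` and `LL` cancel, by symmetry of `LL`.
  have i1 : inner ℝ (z - z') z' = -(β * inner ℝ (LL l) z') := by
    have : z - z' = -(β • LL l) := by rw [hz]; abel
    rw [this, inner_neg_left, real_inner_smul_left]
  have i2 : inner ℝ (l - l') l' = β * (2 * inner ℝ (LL z') l' - inner ℝ (LL z) l'
      - (2 * inner ℝ (A x') l' - inner ℝ (A x) l')) := by
    rw [hl]
    simp only [map_sub, map_smul, inner_sub_left, real_inner_smul_left]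
  set t := s - B x with ht
  set t' := s' - B x' with ht'
  -- In the shifted variable `s - B x` the tracking update is a plain forward step.
  have htt : t - t' = β • v := by
    rw [ht, ht']
    have : s - B x - (s' - B x') = (s - s') - B (x - x') := by rw [map_sub]; abel
    rw [this, hs]; abel
  have htd : s - s' - B (x - x') = t - t' := by rw [htt, hs]; abel
  have i3 : inner ℝ (t - t') t' = β * inner ℝ v t' := by rw [htt, real_inner_smul_left]
  have i4 : inner ℝ (x - x') x' - β * (inner ℝ h x' + inner ℝ (A x') l) ≥ 0 := by
    rw [inner_sub_left, real_inner_smul_left, inner_add_left,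
      ContinuousLinearMap.adjoint_inner_left, real_inner_comm (A x') l] at hx
    exact hx
  simp only [primalDualEnergy, htd, ← ht, ← ht']
  rw [norm_sub_sq_real x x', norm_sub_sq_real t t', norm_sub_sq_real z z', norm_sub_sq_real l l']
  clear_value t t'
  simp only [map_sub, inner_sub_left, inner_sub_right, real_inner_self_eq_norm_sq] at *
  have c1 : inner ℝ (LL l) z' = inner ℝ (LL z') l := by rw [hLL, real_inner_comm]
  rw [c1] at i1
  linarith

end AbstractIteration
end

/-! ### Tracking problems: invariance, fixed points and Fejér monotonicity -/

noncomputable section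

section AbstractIteration

variable {X S Y : Type*} [NormedAddCommGroup X] [InnerProductSpace ℝ X] [FiniteDimensional ℝ X]
  [NormedAddCommGroup S] [InnerProductSpace ℝ S] [FiniteDimensional ℝ S]
  [NormedAddCommGroup Y] [InnerProductSpace ℝ Y] [FiniteDimensional ℝ Y]

open ContinuousLinearMap (adjoint)

theorem two_smul_sub_self {V : Type*} [AddCommGroup V] [Module ℝ V] (v : V) :
    (2 : ℝ) • v - v = v := by
  rw [two_smul, add_sub_cancel_right]

/-- The data of a tracking problem: `cons x` is the exact aggregate in the consensus space `C`,
which `LS` annihilates, and which a state `s` with `s - cons x ∈ Cᗮ` tracks on average. -/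
structure TrackingData (Ω : Set X) (F : X → X) (Ft : X → S → X) (B : X →L[ℝ] S) (LS : S →L[ℝ] S)
    (C : Submodule ℝ S) (cons : X → S) (μ θ c : ℝ) : Prop where
  closed : IsClosed Ω
  convex : Convex ℝ Ω
  nonempty : Ω.Nonempty
  cons_mem : ∀ x, cons x ∈ C
  cons_sub : ∀ x y, B (x - y) - (cons x - cons y) ∈ Cᗮ
  cons_continuous : Continuous cons
  LS_mem : ∀ s, LS s ∈ Cᗮ
  LS_eq_zero : ∀ s ∈ C, LS s = 0
  coercive : ∀ u ∈ Cᗮ, c * ‖u‖ ^ 2 ≤ inner ℝ (LS u) u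
  extends_F : ∀ x, Ft x (cons x) = F x
  F_mono : ∀ x y, μ * ‖x - y‖ ^ 2 ≤ inner ℝ (F x - F y) (x - y)
  F_lip : ∀ x y, ‖F x - F y‖ ≤ θ * ‖x - y‖
  Ft_lip : ∀ x x' s s', ‖Ft x s - Ft x' s'‖ ≤ θ * √(‖x - x'‖ ^ 2 + ‖s - s'‖ ^ 2)
  μ_pos : 0 < μ
  θ_pos : 0 < θ
  c_pos : 0 < c

/-- The optimality conditions satisfied by the fixed points of the iteration. -/
def IsPrimalDualSolution (Ω : Set X) (F : X → X) (A : X →L[ℝ] Y) (a : Y) (LL : Y →L[ℝ] Y) (α : ℝ)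
    (x : X) (z l : Y) : Prop :=
  x ∈ Ω ∧ (∀ y ∈ Ω, 0 ≤ inner ℝ (α • F x + adjoint A l) (y - x)) ∧ LL l = 0 ∧ LL z - A x + a = 0

variable {Ω : Set X} {F : X → X} {Ft : X → S → X} {B : X →L[ℝ] S} {LS : S →L[ℝ] S}
  {C : Submodule ℝ S} {cons : X → S} {μ θ c : ℝ}

namespace TrackingData

omit [FiniteDimensional ℝ X] [FiniteDimensional ℝ S] in
theorem norm_Ft_sub_le (T : TrackingData Ω F Ft B LS C cons μ θ c) (x : X) (s s' : S) :
    ‖Ft x s - Ft x s'‖ ≤ θ * ‖s - s'‖ := by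
  simpa [Real.sqrt_sq (norm_nonneg _)] using T.Ft_lip x x s s'

omit [FiniteDimensional ℝ X] [FiniteDimensional ℝ S] in
theorem continuous_Ft (T : TrackingData Ω F Ft B LS C cons μ θ c) :
    Continuous fun p : X × S => Ft p.1 p.2 := by
  refine continuous_iff_continuousAt.2 fun p => ?_
  rw [ContinuousAt, tendsto_iff_norm_sub_tendsto_zero]
  have h : Continuous fun q : X × S => θ * √(‖q.1 - p.1‖ ^ 2 + ‖q.2 - p.2‖ ^ 2) := by fun_prop
  refine squeeze_zero (fun _ => norm_nonneg _) (fun q => T.Ft_lip _ _ _ _) ?_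
  simpa using h.tendsto p

omit [FiniteDimensional ℝ X] [FiniteDimensional ℝ S] in
theorem eq_cons_of_LS_eq_zero (T : TrackingData Ω F Ft B LS C cons μ θ c) {x : X} {s : S}
    (h : s - cons x ∈ Cᗮ) (h0 : LS s = 0) : s = cons x := by
  have h1 := T.coercive _ h
  rw [map_sub, h0, T.LS_eq_zero _ (T.cons_mem x), sub_zero, inner_zero_left] at h1
  have h2 : ‖s - cons x‖ ^ 2 = 0 := le_antisymm (by nlinarith [T.c_pos]) (sq_nonneg _)
  exact sub_eq_zero.1 (norm_eq_zero.1 (pow_eq_zero_iff two_ne_zero |>.1 h2))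

theorem continuous_step (T : TrackingData Ω F Ft B LS C cons μ θ c) (A : X →L[ℝ] Y) (a : Y)
    (LL : Y →L[ℝ] Y) (α β : ℝ) : Continuous (primalDualStep Ω Ft B LS A a LL α β) := by
  have h1 := continuous_metricProj T.closed T.convex T.nonempty
  have h2 := T.continuous_Ft
  have h3 : Continuous fun w : X × S × Y × Y => metricProj Ω (w.1 - β • (α • Ft w.1 w.2.1 +
      adjoint B (LS w.2.1) + adjoint A w.2.2.2)) := by
    refine h1.comp ?_
    have : Continuous fun w : X × S × Y × Y => Ft w.1 w.2.1 :=
      h2.comp (continuous_fst.prodMk continuous_snd.fst)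
    fun_prop
  change Continuous fun w : X × S × Y × Y => _
  unfold primalDualStep
  simp only
  fun_prop

/-- The update `LS s` has no consensus component, and `B (x' - x)` changes the consensus component
of `s` exactly as `cons` changes. -/
theorem step_mem (T : TrackingData Ω F Ft B LS C cons μ θ c) (A : X →L[ℝ] Y) (a : Y)
    (LL : Y →L[ℝ] Y) (α β : ℝ) {w : X × S × Y × Y} (hw : w.2.1 - cons w.1 ∈ Cᗮ) :
    (primalDualStep Ω Ft B LS A a LL α β w).2.1 -
      cons (primalDualStep Ω Ft B LS A a LL α β w).1 ∈ Cᗮ := by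
  obtain ⟨x, s, z, l⟩ := w
  simp only [primalDualStep] at hw ⊢
  set x' := metricProj Ω (x - β • (α • Ft x s + adjoint B (LS s) + adjoint A l))
  have : s - β • LS s + B (x' - x) - cons x' =
      (s - cons x) - β • LS s + (B (x' - x) - (cons x' - cons x)) := by abel
  rw [this]
  exact add_mem (sub_mem hw (Submodule.smul_mem _ _ (T.LS_mem s))) (T.cons_sub x' x)

/-- At a fixed point the tracking error lies both in `Cᗮ` and in the kernel of `LS`, so coercivity
kills it; what is left of the projection step is the variational inequality. -/
theorem step_eq_self_iff (T : TrackingData Ω F Ft B LS C cons μ θ c) (A : X →L[ℝ] Y) (a : Y)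
    (LL : Y →L[ℝ] Y) (α : ℝ) {β : ℝ} (hβ : 0 < β) {x : X} {s : S} {z l : Y}
    (hw : s - cons x ∈ Cᗮ) :
    primalDualStep Ω Ft B LS A a LL α β (x, s, z, l) = (x, s, z, l) ↔
      s = cons x ∧ IsPrimalDualSolution Ω F A a LL α x z l := by
  simp only [primalDualStep, Prod.mk.injEq]
  constructor
  · rintro ⟨hx, hs, hz, hl⟩
    have hl0 : LL l = 0 := (smul_eq_zero.1 (add_eq_left.1 hz)).resolve_left hβ.ne'
    rw [hl0, smul_zero, add_zero, hx, two_smul_sub_self, two_smul_sub_self] at hl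
    rw [hx, sub_self, map_zero, add_zero] at hs
    have hs0 : LS s = 0 := (smul_eq_zero.1 (sub_eq_self.1 hs)).resolve_left hβ.ne'
    have hsc := T.eq_cons_of_LS_eq_zero hw hs0
    refine ⟨hsc, hx ▸ metricProj_mem T.closed T.nonempty _, fun y hy => ?_, hl0,
      (smul_eq_zero.1 (sub_eq_self.1 hl)).resolve_left hβ.ne'⟩
    have h := inner_metricProj_le_zero T.closed T.convex T.nonempty
      (x - β • (α • Ft x s + adjoint B (LS s) + adjoint A l)) hy
    rw [hx, hs0, map_zero, add_zero, hsc, T.extends_F, sub_sub_cancel_left, inner_neg_left,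
      real_inner_smul_left] at h
    nlinarith
  · rintro ⟨rfl, hx, hvi, hl, hz⟩
    have hs0 := T.LS_eq_zero _ (T.cons_mem x)
    have hp : metricProj Ω (x - β • (α • Ft x (cons x) + adjoint B (LS (cons x)) + adjoint A l))
        = x := by
      refine metricProj_eq_of_inner_le_zero T.closed T.convex hx fun y hy => ?_
      rw [hs0, map_zero, add_zero, T.extends_F, sub_sub_cancel_left, inner_neg_left,
        real_inner_smul_left]
      nlinarith [mul_nonneg hβ.le (hvi y hy)]
    rw [hp, hs0, hl, smul_zero, smul_zero, sub_zero, add_zero, two_smul_sub_self,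
      two_smul_sub_self, hz]
    simp

omit [FiniteDimensional ℝ X] [FiniteDimensional ℝ S] in
/-- Restricted strong monotonicity of the forward operator, with the loss incurred by evaluating it
at the previous iterate. -/
theorem forward_inner_ge (T : TrackingData Ω F Ft B LS C cons μ θ c) {α : ℝ} (hα : 0 < α)
    (hα' : α < μ * c / θ ^ 2) {κ K : ℝ} (hκ : κ = min (α * μ / 2) (c / 2))
    (hK : K = α * θ + ‖LS‖ * (‖B‖ + 1)) {x xs : X} {s : S} (hs : s - cons x ∈ Cᗮ)
    (Δx : X) (Δs : S) :
    -(K ^ 2 / κ * (‖Δx‖ ^ 2 + ‖Δs‖ ^ 2)) ≤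
      inner ℝ (α • (Ft x s - F xs)) (x - xs - Δx) +
        inner ℝ (LS s) (s - cons xs - (B Δx + Δs)) := by
  set u := s - cons x with hu
  have hθ := T.θ_pos
  have hc := T.c_pos
  have hμ := T.μ_pos
  have hκ0 : 0 < κ := by rw [hκ]; positivity
  have hκ1 : κ ≤ α * μ / 2 := hκ ▸ min_le_left _ _
  have hκ2 : κ ≤ c / 2 := hκ ▸ min_le_right _ _
  have hK0 : 0 ≤ K := by rw [hK]; positivity
  have hLS : LS s = LS u := by rw [hu, map_sub, T.LS_eq_zero _ (T.cons_mem x), sub_zero]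
  have hdu : ‖Ft x s - F x‖ ≤ θ * ‖u‖ := by
    rw [← T.extends_F x]; exact T.norm_Ft_sub_le x s (cons x)
  have hdF : ‖Ft x s - F xs‖ ≤ θ * (‖x - xs‖ + ‖u‖) := by
    have : Ft x s - F xs = (Ft x s - F x) + (F x - F xs) := by abel
    rw [this]
    refine (norm_add_le _ _).trans ?_
    linarith [T.F_lip x xs]
  have b1 : μ * ‖x - xs‖ ^ 2 - θ * ‖u‖ * ‖x - xs‖ ≤ inner ℝ (Ft x s - F xs) (x - xs) := by
    have : Ft x s - F xs = (Ft x s - F x) + (F x - F xs) := by abel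
    rw [this, inner_add_left]
    have h1 := T.F_mono x xs
    have h2 := (neg_le_abs _).trans (abs_real_inner_le_norm (Ft x s - F x) (x - xs))
    have h3 := mul_le_mul_of_nonneg_right hdu (norm_nonneg (x - xs))
    linarith
  -- `LS s` is orthogonal to `cons x - cons xs`, so only the tracking error contributes.
  have b2 : c * ‖u‖ ^ 2 ≤ inner ℝ (LS s) (s - cons xs) := by
    have e : s - cons xs = u + (cons x - cons xs) := by rw [hu]; abel
    have e0 : inner ℝ (LS u) (cons x - cons xs) = 0 :=
      Submodule.inner_left_of_mem_orthogonal (sub_mem (T.cons_mem x) (T.cons_mem xs))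
        (T.LS_mem u)
    rw [hLS, e, inner_add_right, e0, add_zero]
    exact T.coercive u hs
  have b3 : inner ℝ (Ft x s - F xs) Δx ≤ θ * (‖x - xs‖ + ‖u‖) * ‖Δx‖ :=
    (real_inner_le_norm _ _).trans (by gcongr)
  have b4 : inner ℝ (LS s) (B Δx + Δs) ≤ ‖LS‖ * ‖u‖ * (‖B‖ * ‖Δx‖ + ‖Δs‖) := by
    rw [hLS]
    refine (real_inner_le_norm _ _).trans ?_
    gcongr
    · exact LS.le_opNorm u
    · refine (norm_add_le _ _).trans ?_
      gcongr
      exact B.le_opNorm Δx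
  rw [real_inner_smul_left, inner_sub_right _ _ Δx, inner_sub_right (LS s)]
  generalize inner ℝ (Ft x s - F xs) (x - xs) = i1 at *
  generalize inner ℝ (LS s) (s - cons xs) = i2 at *
  generalize inner ℝ (Ft x s - F xs) Δx = i3 at *
  generalize inner ℝ (LS s) (B Δx + Δs) = i4 at *
  have hp := norm_nonneg (x - xs)
  have hq := norm_nonneg u
  have hm := norm_nonneg Δx
  have hn := norm_nonneg Δs
  have hB := norm_nonneg B
  have hL := norm_nonneg LS
  generalize ‖x - xs‖ = p at *
  generalize ‖u‖ = q at *
  generalize ‖Δx‖ = m at *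
  generalize ‖Δs‖ = n at *
  have c1 := mul_le_mul_of_nonneg_left b1 hα.le
  have c3 := mul_le_mul_of_nonneg_left b3 hα.le
  have c4 : α * (θ * (p + q) * m) + ‖LS‖ * q * (‖B‖ * m + n) ≤ K * ((p + q) * (m + n)) := by
    have h1 : α * θ * ((p + q) * m) ≤ α * θ * ((p + q) * (m + n)) := by gcongr; linarith
    have h2 : q * (‖B‖ * m + n) ≤ (p + q) * ((‖B‖ + 1) * (m + n)) := by
      gcongr
      · linarith
      · nlinarith [mul_nonneg hB hn]
    have h3 := mul_le_mul_of_nonneg_left h2 hL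
    rw [hK]
    linarith
  -- Young's inequality with weight `κ`: half of the monotonicity pays for evaluating at the old
  -- iterate, leaving only a multiple of the squared increment.
  have c5 : K * ((p + q) * (m + n)) ≤ κ * (p ^ 2 + q ^ 2) + K ^ 2 / κ * (m ^ 2 + n ^ 2) := by
    have h1 : K * ((p + q) * (m + n)) ≤ κ * ((p + q) ^ 2 / 2) + K ^ 2 / κ * ((m + n) ^ 2 / 2) := by
      have h0 : 0 ≤ (κ * (p + q) - K * (m + n)) ^ 2 / (2 * κ) := by positivity
      have : (κ * (p + q) - K * (m + n)) ^ 2 / (2 * κ) = κ * ((p + q) ^ 2 / 2) +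
          K ^ 2 / κ * ((m + n) ^ 2 / 2) - K * ((p + q) * (m + n)) := by field_simp; ring
      linarith
    have h2 : κ * ((p + q) ^ 2 / 2) ≤ κ * (p ^ 2 + q ^ 2) := by
      gcongr; nlinarith [sq_nonneg (p - q)]
    have h3 : K ^ 2 / κ * ((m + n) ^ 2 / 2) ≤ K ^ 2 / κ * (m ^ 2 + n ^ 2) := by
      gcongr; nlinarith [sq_nonneg (m - n)]
    linarith
  -- The other half pays for the tracking error. Completing the square in `μ p - θ q` leaves the
  -- coefficient `αθ² / (2μ)`, below `c / 2` exactly when `α < μc / θ²`.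
  have c6 : α * (θ * q * p) ≤ α * μ / 2 * p ^ 2 + c / 2 * q ^ 2 := by
    have h1 : α * θ ^ 2 < μ * c := by rwa [lt_div_iff₀ (by positivity)] at hα'
    have h2 : 0 ≤ α * (μ * p - θ * q) ^ 2 / (2 * μ) := by positivity
    have h3 : α * (μ * p - θ * q) ^ 2 / (2 * μ) =
        α * μ / 2 * p ^ 2 - α * (θ * q * p) + α * θ ^ 2 / (2 * μ) * q ^ 2 := by field_simp; ring
    have h4 : α * θ ^ 2 / (2 * μ) * q ^ 2 ≤ c / 2 * q ^ 2 := by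
      refine mul_le_mul_of_nonneg_right ?_ (sq_nonneg q)
      rw [div_le_iff₀ (by positivity)]
      linarith
    linarith
  have c7 : κ * (p ^ 2 + q ^ 2) ≤ α * μ / 2 * p ^ 2 + c / 2 * q ^ 2 := by
    rw [mul_add]; gcongr
  linarith

theorem energy_decrease (T : TrackingData Ω F Ft B LS C cons μ θ c) (A : X →L[ℝ] Y) (a : Y)
    (LL : Y →L[ℝ] Y) (hLL : ∀ y y', inner ℝ (LL y) y' = inner ℝ y (LL y'))
    {α β : ℝ} (hα : 0 < α) (hα' : α < μ * c / θ ^ 2) {κ K : ℝ}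
    (hκ : κ = min (α * μ / 2) (c / 2)) (hK : K = α * θ + ‖LS‖ * (‖B‖ + 1))
    (hβ : 0 ≤ β) (hβ1 : β * (‖A‖ + ‖LL‖) ≤ 1 / 2) (hβ2 : β * (8 * (K ^ 2 / κ)) ≤ 1)
    {xs : X} {zs ls : Y} (hsol : IsPrimalDualSolution Ω F A a LL α xs zs ls)
    {w : X × S × Y × Y} (hw : w.2.1 - cons w.1 ∈ Cᗮ) :
    primalDualEnergy B A LL β (primalDualStep Ω Ft B LS A a LL α β w - (xs, cons xs, zs, ls)) +
      1 / (4 * (2 + 2 * ‖B‖ ^ 2)) * ‖w - primalDualStep Ω Ft B LS A a LL α β w‖ ^ 2 ≤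
      primalDualEnergy B A LL β (w - (xs, cons xs, zs, ls)) := by
  obtain ⟨x, s, z, l⟩ := w
  obtain ⟨hxs, hvi, hls, hzs⟩ := hsol
  set w' := primalDualStep Ω Ft B LS A a LL α β (x, s, z, l) with hw'
  obtain ⟨x', s', z', l'⟩ := w'
  simp only [primalDualStep, Prod.mk.injEq] at hw' hw
  obtain ⟨hx', hs', hz', hl'⟩ := hw'
  rw [← hx'] at hs' hl'
  rw [← hz'] at hl'
  set h := α • (Ft x s - F xs) + adjoint B (LS s) with hh
  have hproj : 0 ≤ inner ℝ (x - xs - (x' - xs) - β • (h + adjoint A (l - ls))) (x' - xs) := by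
    have h1 := inner_metricProj_le_zero T.closed T.convex T.nonempty
      (x - β • (α • Ft x s + adjoint B (LS s) + adjoint A l)) hxs
    rw [← hx', ← neg_sub x' xs, inner_neg_right] at h1
    have h2 := mul_nonneg hβ (hvi x' (hx' ▸ metricProj_mem T.closed T.nonempty _))
    rw [← real_inner_smul_left] at h2
    have e : x - xs - (x' - xs) - β • (h + adjoint A (l - ls)) =
        (x - β • (α • Ft x s + adjoint B (LS s) + adjoint A l) - x') +
          β • (α • F xs + adjoint A ls) := by
      rw [hh, map_sub]; module
    rw [e, inner_add_left]
    linarith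
  have hds : s - cons xs - (s' - cons xs) = β • LS s + B (x - xs - (x' - xs)) := by
    rw [hs', map_sub, map_sub, map_sub, map_sub]; abel
  have hdz : z' - zs = z - zs + β • LL (l - ls) := by rw [hz', map_sub, hls, sub_zero]; abel
  have hdl : l - ls - (l' - ls) = β • (LL ((2 : ℝ) • (z' - zs) - (z - zs)) -
      A ((2 : ℝ) • (x' - xs) - (x - xs))) := by
    have e1 : (2 : ℝ) • (z' - zs) - (z - zs) = ((2 : ℝ) • z' - z) - zs := by module
    have e2 : (2 : ℝ) • (x' - xs) - (x - xs) = ((2 : ℝ) • x' - x) - xs := by module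
    have e3 : LL ((2 : ℝ) • z' - z) - LL zs - (A ((2 : ℝ) • x' - x) - A xs) =
        LL ((2 : ℝ) • z' - z) - A ((2 : ℝ) • x' - x) + a - (LL zs - A xs + a) := by abel
    rw [e1, e2, map_sub _ _ zs, map_sub _ _ xs, e3, hzs, sub_zero, hl']
    abel
  have main := primalDualEnergy_step B A LL hLL hproj hds hdz hdl
  have hlow := half_le_primalDualEnergy B A LL hβ hβ1 (x - x', s - s', z - z', l - l')
  have hnorm := norm_sq_le_sum_sq B (x - x', s - s', z - z', l - l')
  have hfwd := T.forward_inner_ge hα hα' hκ hK (xs := xs) hw (x - x') (s - s' - B (x - x'))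
  -- The term `adjoint B (LS s)` of the primal update cancels the shift by `B` in the energy
  -- variable, so `LS s` is paired with `s' - cons xs` alone.
  have e5 : inner ℝ h (x' - xs) + inner ℝ (LS s) (s' - cons xs - B (x' - xs)) =
      inner ℝ (α • (Ft x s - F xs)) (x - xs - (x - x')) +
        inner ℝ (LS s) (s - cons xs - (B (x - x') + (s - s' - B (x - x')))) := by
    have e6 : x - xs - (x - x') = x' - xs := by abel
    have e7 : s - cons xs - (B (x - x') + (s - s' - B (x - x'))) = s' - cons xs := by abel
    rw [e6, e7, hh, inner_add_left, ContinuousLinearMap.adjoint_inner_left,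
      inner_sub_right (LS s) (s' - cons xs)]
    ring
  simp only [sub_sub_sub_cancel_right] at main
  rw [e5] at main
  simp only [Prod.mk_sub_mk] at *
  have hβf := mul_le_mul_of_nonneg_left hfwd hβ
  set R := ‖x - x'‖ ^ 2 + ‖s - s' - B (x - x')‖ ^ 2 + ‖z - z'‖ ^ 2 + ‖l - l'‖ ^ 2 with hR
  -- Of the increment energy, at least `R / 2`, one `R / 4` absorbs the forward loss `2βK²/κ`; the
  -- other bounds the residual.
  have hsmall : β * (8 * (K ^ 2 / κ)) * (‖x - x'‖ ^ 2 + ‖s - s' - B (x - x')‖ ^ 2) ≤ 1 * R := by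
    have : ‖x - x'‖ ^ 2 + ‖s - s' - B (x - x')‖ ^ 2 ≤ R := by
      rw [hR]; nlinarith [sq_nonneg ‖z - z'‖, sq_nonneg ‖l - l'‖]
    gcongr
  have hlast : 1 / (4 * (2 + 2 * ‖B‖ ^ 2)) * ‖(x - x', s - s', z - z', l - l')‖ ^ 2 ≤ 1 / 4 * R := by
    have hpos : 0 < 2 + 2 * ‖B‖ ^ 2 := by positivity
    rw [one_div_mul_eq_div, div_le_iff₀ (by positivity)]
    linarith
  linarith

theorem exists_stepSize_tendsto (T : TrackingData Ω F Ft B LS C cons μ θ c) (A : X →L[ℝ] Y) (a : Y)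
    (LL : Y →L[ℝ] Y) (hLL : ∀ y y', inner ℝ (LL y) y' = inner ℝ y (LL y'))
    {α : ℝ} (hα : 0 < α) (hα' : α < μ * c / θ ^ 2)
    (hex : ∃ x z l, IsPrimalDualSolution Ω F A a LL α x z l) :
    ∃ β₀ > 0, ∀ β : ℝ, 0 < β → β < β₀ → ∀ w : X × S × Y × Y, w.2.1 - cons w.1 ∈ Cᗮ →
      ∃ x z l, IsPrimalDualSolution Ω F A a LL α x z l ∧
        Tendsto (fun k => (primalDualStep Ω Ft B LS A a LL α β)^[k] w) atTop
          (𝓝 (x, cons x, z, l)) := by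
  obtain ⟨κ, hκ⟩ : ∃ κ, κ = min (α * μ / 2) (c / 2) := ⟨_, rfl⟩
  obtain ⟨K, hK⟩ : ∃ K, K = α * θ + ‖LS‖ * (‖B‖ + 1) := ⟨_, rfl⟩
  have hκ0 : 0 < κ := by
    have := T.μ_pos
    have := T.c_pos
    rw [hκ]; positivity
  have hK2 : 0 ≤ 8 * (K ^ 2 / κ) := by positivity
  have hden : 0 < 2 * (‖A‖ + ‖LL‖) + 8 * (K ^ 2 / κ) + 1 := by positivity
  -- The denominator adds up the two step-size requirements; the final `1` keeps it positive.
  refine ⟨1 / (2 * (‖A‖ + ‖LL‖) + 8 * (K ^ 2 / κ) + 1), by positivity, fun β hβ hβ₀ w hw => ?_⟩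
  rw [lt_div_iff₀ hden] at hβ₀
  have hn : 0 ≤ β * (‖A‖ + ‖LL‖) := by positivity
  have hβ1 : β * (‖A‖ + ‖LL‖) ≤ 1 / 2 := by nlinarith [mul_nonneg hβ.le hK2]
  have hβ2 : β * (8 * (K ^ 2 / κ)) ≤ 1 := by nlinarith
  have hfix : ∀ p : X × S × Y × Y, p.2.1 - cons p.1 ∈ Cᗮ →
      primalDualStep Ω Ft B LS A a LL α β p = p →
      p = (p.1, cons p.1, p.2.2.1, p.2.2.2) ∧
        IsPrimalDualSolution Ω F A a LL α p.1 p.2.2.1 p.2.2.2 := by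
    rintro ⟨x, s, z, l⟩ hp hpp
    obtain ⟨h1, h2⟩ := (T.step_eq_self_iff A a LL α hβ hp).1 hpp
    exact ⟨by rw [← h1], h2⟩
  obtain ⟨p, hp, hpp, hlim⟩ := tendsto_iterate_of_fejer
    (T := primalDualStep Ω Ft B LS A a LL α β) (T.continuous_step A a LL α β)
    (Adm := {w | w.2.1 - cons w.1 ∈ Cᗮ})
    (C.isClosed_orthogonal.preimage
      (continuous_snd.fst.sub (T.cons_continuous.comp continuous_fst)))
    (fun w hw => T.step_mem A a LL α β hw)
    (D := fun w p => primalDualEnergy B A LL β (w - p))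
    (fun p => by unfold primalDualEnergy; fun_prop)
    (fun p => by simp [primalDualEnergy])
    (c := 1 / (4 * (2 + 2 * ‖B‖ ^ 2))) (by positivity)
    (fun w p => by
      have h1 := half_le_primalDualEnergy B A LL hβ.le hβ1 (w - p)
      have h2 := norm_sq_le_sum_sq B (w - p)
      have h3 : 0 < 2 + 2 * ‖B‖ ^ 2 := by positivity
      rw [one_div_mul_eq_div, div_le_iff₀ (by positivity)]
      have h4 := mul_le_mul_of_nonneg_left h1 h3.le
      nlinarith [sq_nonneg ‖w - p‖])
    (fun p hp hpp w hw => by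
      obtain ⟨e, hsol⟩ := hfix p hp hpp
      rw [e]
      exact T.energy_decrease A a LL hLL hα hα' hκ hK hβ.le hβ1 hβ2 hsol hw)
    (by
      obtain ⟨x, z, l, hsol⟩ := hex
      have hm : cons x - cons x ∈ Cᗮ := by rw [sub_self]; exact zero_mem _
      exact ⟨(x, cons x, z, l), hm, (T.step_eq_self_iff A a LL α hβ hm).2 ⟨rfl, hsol⟩⟩)
    hw
  obtain ⟨e, hsol⟩ := hfix p hp hpp
  exact ⟨_, _, _, hsol, e ▸ hlim⟩

end TrackingData

end AbstractIteration

end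

noncomputable section

/-! ### Coercivity, gradients and convexity -/

/-- The quadratic form attains a positive minimum on the compact unit sphere of `U`, and homogeneity
does the rest. No symmetry of `T` is needed. -/
theorem exists_coercive_of_inner_nonneg {S : Type*} [NormedAddCommGroup S] [InnerProductSpace ℝ S]
    [FiniteDimensional ℝ S] (T : S →L[ℝ] S) (U : Submodule ℝ S)
    (h0 : ∀ u ∈ U, 0 ≤ inner ℝ (T u) u) (h1 : ∀ u ∈ U, inner ℝ (T u) u = 0 → u = 0) :
    ∃ c > 0, ∀ u ∈ U, c * ‖u‖ ^ 2 ≤ inner ℝ (T u) u := by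
  have hcpt : IsCompact (Metric.sphere (0 : S) 1 ∩ U) :=
    (isCompact_sphere 0 1).inter_right U.closed_of_finiteDimensional
  obtain ⟨c, hc, hcU⟩ : ∃ c > 0, ∀ v ∈ Metric.sphere (0 : S) 1 ∩ U, c ≤ inner ℝ (T v) v := by
    rcases (Metric.sphere (0 : S) 1 ∩ U).eq_empty_or_nonempty with he | hne
    · exact ⟨1, one_pos, by simp [he]⟩
    · obtain ⟨v, hv, hmin⟩ := hcpt.exists_isMinOn hne
        (f := fun v => inner ℝ (T v) v) (by fun_prop)
      refine ⟨_, lt_of_le_of_ne (h0 v hv.2) fun h => ?_, fun w hw => hmin hw⟩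
      have := h1 v hv.2 h.symm
      simp [this] at hv
  refine ⟨c, hc, fun u hu => ?_⟩
  rcases eq_or_ne u 0 with rfl | hne
  · simp
  have hn : 0 < ‖u‖ := norm_pos_iff.2 hne
  have h := hcU (‖u‖⁻¹ • u) ⟨by simp [norm_smul, hn.ne'], U.smul_mem _ hu⟩
  rw [map_smul, real_inner_smul_left, real_inner_smul_right] at h
  calc c * ‖u‖ ^ 2 ≤ ‖u‖⁻¹ * (‖u‖⁻¹ * inner ℝ (T u) u) * ‖u‖ ^ 2 := by gcongr
    _ = inner ℝ (T u) u := by field_simp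

theorem real_inner_gradient {E : Type*} [NormedAddCommGroup E] [InnerProductSpace ℝ E]
    [CompleteSpace E] (f : E → ℝ) (x v : E) : inner ℝ (gradient f x) v = fderiv ℝ f x v := by
  rw [← toDual_gradient, InnerProductSpace.toDual_apply_apply]

theorem ConvexOn.inner_gradient_le_sub {E : Type*} [NormedAddCommGroup E] [InnerProductSpace ℝ E]
    [CompleteSpace E] {f : E → ℝ} (hf : ConvexOn ℝ Set.univ f) {x : E}
    (hd : DifferentiableAt ℝ f x) (y : E) : inner ℝ (gradient f x) (y - x) ≤ f y - f x := by
  have hl := hf.comp_affineMap (AffineMap.lineMap x y : ℝ →ᵃ[ℝ] E)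
  have hd' : HasDerivAt (f ∘ (AffineMap.lineMap x y : ℝ →ᵃ[ℝ] E))
      (fderiv ℝ f x (y - x)) 0 := by
    refine HasFDerivAt.comp_hasDerivAt (0 : ℝ) ?_ AffineMap.hasDerivAt_lineMap
    rw [AffineMap.lineMap_apply_zero]
    exact hd.hasFDerivAt
  have := hl.le_slope_of_hasDerivAt (Set.mem_univ (0 : ℝ)) (Set.mem_univ (1 : ℝ)) one_pos hd'
  rw [real_inner_gradient]
  simpa [slope_def_field] using this

/-! ### Consensus spaces and Laplacians -/

namespace EstimateDesign

variable {I P : ℕ} {comm : Fin I → Fin I → Prop} {interf : Finset (Fin P × Fin I)}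
  (D : EstimateDesign comm interf) {n : Fin P → ℕ}

/-- Agents keeping no estimate have no interference edge, so their terms vanish. -/
theorem sum_holder {V : Type*} [AddCommMonoid V] (p : Fin P) (f : Fin I → V)
    (hf : ∀ i, (p, i) ∉ interf → f i = 0) : ∑ i : D.Holder p, f i.1 = ∑ i, f i := by
  rw [← Finset.sum_subtype (Finset.univ.filter fun i => (p, i) ∈ D.est) (by simp) f]
  refine Finset.sum_subset (Finset.subset_univ _) fun i _ hi => hf i fun h => hi ?_
  simpa using D.interf_subset h

/-- The consensus map as a linear map. -/
def consensusLinear (n : Fin P → ℕ) : BlockVec n →ₗ[ℝ] D.Est n where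
  toFun := D.consensus
  map_add' _ _ := rfl
  map_smul' _ _ := rfl

/-- The subspace of consensus vectors. -/
def consensusSpace (n : Fin P → ℕ) : Submodule ℝ (D.Est n) := LinearMap.range (D.consensusLinear n)

theorem consensus_mem (y : BlockVec n) : D.consensus y ∈ D.consensusSpace n := ⟨y, rfl⟩

theorem inner_est (y y' : D.Est n) :
    inner ℝ y y' = ∑ p, ∑ i : D.Holder p, inner ℝ (y p i) (y' p i) := by
  rw [PiLp.inner_apply]
  exact Finset.sum_congr rfl fun p _ => PiLp.inner_apply _ _

theorem mem_consensusSpace_orthogonal {u : D.Est n} (h : ∀ p, ∑ i, u p i = 0) :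
    u ∈ (D.consensusSpace n)ᗮ := by
  rw [Submodule.mem_orthogonal]
  rintro _ ⟨y, rfl⟩
  rw [inner_est]
  refine Finset.sum_eq_zero fun p _ => ?_
  have : ∑ i : D.Holder p, inner ℝ (y p) (u p i) = 0 := by rw [← inner_sum, h, inner_zero_right]
  exact this

theorem exists_eq_consensus {y : D.Est n} (h : ∀ p, ∀ i j : D.Holder p, y p i = y p j) :
    ∃ v : BlockVec n, y = D.consensus v := by
  classical
  -- Blocks that no agent keeps get the default value `0`.
  refine ⟨WithLp.toLp 2 fun p => if hp : Nonempty (D.Holder p) then y p hp.some else 0, ?_⟩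
  ext p i : 2
  have hp : Nonempty (D.Holder p) := ⟨i⟩
  change y p i = if hp : Nonempty (D.Holder p) then y p hp.some else 0
  rw [dif_pos hp]
  exact h p i _

theorem lap_apply (y : D.Est n) (p : Fin P) (i : D.Holder p) :
    D.lap y p i = ∑ j, D.weight p i j • (y p i - y p j) := by
  classical
  change ∑ j, D.laplacian p i j • y p j = _
  simp only [laplacian, Matrix.sub_apply, sub_smul, smul_sub, Finset.sum_sub_distrib,
    Matrix.diagonal_apply, ite_smul, zero_smul, Finset.sum_ite_eq, Finset.mem_univ, if_true,
    Finset.sum_smul]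

/-- The stacked Laplacian as a continuous linear map. -/
def lapCLM (n : Fin P → ℕ) : D.Est n →L[ℝ] D.Est n :=
  LinearMap.toContinuousLinearMap
    { toFun := D.lap
      map_add' := fun y y' => by
        ext p i : 2
        change D.lap (y + y') p i = D.lap y p i + D.lap y' p i
        simp only [lap_apply, ← Finset.sum_add_distrib, ← smul_add]
        refine Finset.sum_congr rfl fun j _ => ?_
        congr 1
        exact add_sub_add_comm _ _ _ _
      map_smul' := fun r y => by
        ext p i : 2
        change D.lap (r • y) p i = r • D.lap y p i
        simp only [lap_apply, Finset.smul_sum]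
        refine Finset.sum_congr rfl fun j _ => ?_
        rw [smul_comm r, smul_sub r]
        rfl }

theorem lapCLM_apply (y : D.Est n) : D.lapCLM n y = D.lap y := rfl

theorem weight_nonneg (p : Fin P) (i j : D.Holder p) : 0 ≤ D.weight p i j := by
  by_cases h : D.edge p j i
  · exact (D.weight_pos p j i h).le
  · exact (D.weight_eq_zero p j i h).ge

theorem lap_consensus (v : BlockVec n) : D.lap (D.consensus v) = 0 := by
  ext p i : 2
  rw [lap_apply]
  refine Finset.sum_eq_zero fun j _ => ?_
  change D.weight p i j • (v p - v p) = 0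
  rw [sub_self, smul_zero]

variable {D}

theorem SymmetricWeights.balanced (h : D.SymmetricWeights) : D.BalancedWeights :=
  fun p i => Finset.sum_congr rfl fun j _ => (h p).apply j i

theorem BalancedWeights.sum_sum_smul {V : Type*} [AddCommGroup V] [Module ℝ V]
    (h : D.BalancedWeights) (p : Fin P) (f : D.Holder p → V) :
    ∑ i, ∑ j, D.weight p i j • f j = ∑ i, ∑ j, D.weight p i j • f i := by
  rw [Finset.sum_comm]
  refine Finset.sum_congr rfl fun i _ => ?_
  rw [← Finset.sum_smul, ← Finset.sum_smul, h p i]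

theorem BalancedWeights.lap_mem (h : D.BalancedWeights) (y : D.Est n) :
    D.lap y ∈ (D.consensusSpace n)ᗮ := by
  refine D.mem_consensusSpace_orthogonal fun p => ?_
  simp only [lap_apply, smul_sub, Finset.sum_sub_distrib]
  rw [h.sum_sum_smul p, sub_self]

/-- Balance equates the sums weighted by in-degree and out-degree, so the Laplacian form is a sum of
squares even for directed graphs. -/
theorem BalancedWeights.two_mul_inner_lap (h : D.BalancedWeights) (y : D.Est n) :
    2 * inner ℝ (D.lap y) y = ∑ p, ∑ i, ∑ j, D.weight p i j * ‖y p i - y p j‖ ^ 2 := by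
  rw [inner_est, Finset.mul_sum]
  refine Finset.sum_congr rfl fun p _ => ?_
  have key : ∑ i, ∑ j, D.weight p i j * ‖y p j‖ ^ 2 = ∑ i, ∑ j, D.weight p i j * ‖y p i‖ ^ 2 :=
    h.sum_sum_smul p fun j => ‖y p j‖ ^ 2
  have e1 : ∑ i, inner ℝ (D.lap y p i) (y p i) =
      ∑ i, ∑ j, (D.weight p i j * ‖y p i‖ ^ 2 - D.weight p i j * inner ℝ (y p i) (y p j)) := by
    refine Finset.sum_congr rfl fun i _ => ?_
    rw [lap_apply, sum_inner]
    refine Finset.sum_congr rfl fun j _ => ?_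
    rw [real_inner_smul_left, inner_sub_left, real_inner_self_eq_norm_sq, real_inner_comm]
    ring
  have e2 : ∑ i, ∑ j, D.weight p i j * ‖y p i - y p j‖ ^ 2 =
      ∑ i, ∑ j, (D.weight p i j * ‖y p i‖ ^ 2 - 2 * (D.weight p i j * inner ℝ (y p i) (y p j)) +
        D.weight p i j * ‖y p j‖ ^ 2) := by
    refine Finset.sum_congr rfl fun i _ => Finset.sum_congr rfl fun j _ => ?_
    rw [norm_sub_sq_real]
    ring
  rw [e1, e2]
  simp only [Finset.sum_add_distrib, Finset.sum_sub_distrib, key, ← Finset.mul_sum]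
  ring

theorem BalancedWeights.inner_lap_nonneg (h : D.BalancedWeights) (y : D.Est n) :
    0 ≤ inner ℝ (D.lap y) y := by
  have h1 := h.two_mul_inner_lap y
  have h2 : 0 ≤ ∑ p, ∑ i, ∑ j, D.weight p i j * ‖y p i - y p j‖ ^ 2 :=
    Finset.sum_nonneg fun p _ => Finset.sum_nonneg fun i _ => Finset.sum_nonneg fun j _ =>
      mul_nonneg (D.weight_nonneg p i j) (sq_nonneg _)
  linarith

/-- A vanishing sum of squares forces equality across each edge, hence along directed paths. -/
theorem BalancedWeights.mem_consensusSpace (h : D.BalancedWeights) (hc : D.StronglyConnected)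
    {y : D.Est n} (hy : inner ℝ (D.lap y) y = 0) : ∃ v : BlockVec n, y = D.consensus v := by
  have h1 := h.two_mul_inner_lap y
  rw [hy, mul_zero] at h1
  have hnn : ∀ p, ∀ i j : D.Holder p, 0 ≤ D.weight p i j * ‖y p i - y p j‖ ^ 2 := fun p i j =>
    mul_nonneg (D.weight_nonneg p i j) (sq_nonneg _)
  have hedge : ∀ p, ∀ i j : D.Holder p, D.edge p j i → y p i = y p j := by
    intro p i j hij
    have a1 := (Finset.sum_eq_zero_iff_of_nonneg fun p _ => Finset.sum_nonneg fun i _ =>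
      Finset.sum_nonneg fun j _ => hnn p i j).1 h1.symm p (Finset.mem_univ p)
    have a2 := (Finset.sum_eq_zero_iff_of_nonneg fun i _ =>
      Finset.sum_nonneg fun j _ => hnn p i j).1 a1 i (Finset.mem_univ i)
    have a3 := (Finset.sum_eq_zero_iff_of_nonneg fun j _ => hnn p i j).1 a2 j (Finset.mem_univ j)
    have a4 := (mul_eq_zero.1 a3).resolve_left (D.weight_pos p j i hij).ne'
    exact sub_eq_zero.1 (norm_eq_zero.1 ((pow_eq_zero_iff two_ne_zero).1 a4))
  refine D.exists_eq_consensus fun p i j => ?_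
  have := hc p i j
  induction this with
  | refl => rfl
  | tail _ hjk ih => exact ih.trans (hedge p _ _ hjk).symm

theorem BalancedWeights.exists_coercive (h : D.BalancedWeights) (hc : D.StronglyConnected) :
    ∃ c > 0, ∀ u ∈ (D.consensusSpace n)ᗮ, c * ‖u‖ ^ 2 ≤ inner ℝ (D.lapCLM n u) u := by
  refine exists_coercive_of_inner_nonneg _ _ (fun u _ => h.inner_lap_nonneg u) fun u hu h0 => ?_
  obtain ⟨v, rfl⟩ := h.mem_consensusSpace hc h0
  exact inner_self_eq_zero.1 (Submodule.inner_right_of_mem_orthogonal (D.consensus_mem v) hu)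

theorem SymmetricWeights.inner_lap_comm (h : D.SymmetricWeights) (y y' : D.Est n) :
    inner ℝ (D.lapCLM n y) y' = inner ℝ y (D.lapCLM n y') := by
  simp only [inner_est, lapCLM_apply]
  refine Finset.sum_congr rfl fun p _ => ?_
  simp only [lap_apply, sum_inner, inner_sum, real_inner_smul_left, real_inner_smul_right,
    inner_sub_left, inner_sub_right, mul_sub, Finset.sum_sub_distrib]
  congr 1
  rw [Finset.sum_comm]
  refine Finset.sum_congr rfl fun i _ => Finset.sum_congr rfl fun j _ => ?_
  rw [(h p).apply]

/-- The range of a symmetric operator is the orthogonal complement of its kernel, here contained in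
the consensus space; zero block sums mean orthogonality to that space. -/
theorem SymmetricWeights.exists_lap_eq (h : D.SymmetricWeights) (hc : D.StronglyConnected)
    {r : D.Est n} (hr : ∀ p, ∑ i, r p i = 0) : ∃ z, D.lapCLM n z = r := by
  have hsymm : (D.lapCLM n : D.Est n →ₗ[ℝ] D.Est n).IsSymmetric := h.inner_lap_comm
  have hrange : r ∈ LinearMap.range (D.lapCLM n : D.Est n →ₗ[ℝ] D.Est n) := by
    rw [← Submodule.orthogonal_orthogonal
      (LinearMap.range (D.lapCLM n : D.Est n →ₗ[ℝ] D.Est n)), hsymm.orthogonal_range]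
    refine Submodule.orthogonal_le ?_ (D.mem_consensusSpace_orthogonal hr)
    intro y hy
    have hy0 : D.lap y = 0 := hy
    obtain ⟨v, rfl⟩ := h.balanced.mem_consensusSpace hc (y := y) (by rw [hy0, inner_zero_left])
    exact D.consensus_mem v
  exact hrange

end EstimateDesign

/-! ### KKT points and variational equilibria -/

theorem replaceBlock_self {P : ℕ} {n : Fin P → ℕ} (x : BlockVec n) (i : Fin P) :
    replaceBlock x i (x i) = x := by
  simp [replaceBlock]

theorem replaceBlock_sub_inner {P : ℕ} {n : Fin P → ℕ} (x v : BlockVec n) (i : Fin P)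
    (y : Vec (n i)) : inner ℝ v (replaceBlock x i y - x) = inner ℝ (v i) (y - x i) := by
  rw [PiLp.inner_apply, Finset.sum_eq_single i]
  · simp [replaceBlock]
  · intro j _ hj
    simp [replaceBlock, hj]
  · simp

namespace GeneralizedGame

variable {I M : ℕ} {nx : Fin I → ℕ} {nlam : Fin M → ℕ} (G : GeneralizedGame nx nlam)

theorem replaceBlock_mem_Omega {x : BlockVec nx} (hx : x ∈ G.Omega) {i : Fin I} {y : Vec (nx i)}
    (hy : y ∈ G.feasible i) : replaceBlock x i y ∈ G.Omega := by
  intro j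
  rcases eq_or_ne j i with rfl | hj
  · simpa [replaceBlock] using hy
  · simpa [replaceBlock, hj] using hx j

theorem mem_normalCone_Omega_iff {x v : BlockVec nx} :
    v ∈ normalCone G.Omega x ↔ ∀ i, v i ∈ normalCone (G.feasible i) (x i) := by
  constructor
  · rintro ⟨hx, h⟩ i
    refine ⟨hx i, fun y hy => ?_⟩
    rw [← replaceBlock_sub_inner]
    exact h _ (G.replaceBlock_mem_Omega hx hy)
  · intro h
    refine ⟨fun i => (h i).1, fun y hy => ?_⟩
    rw [PiLp.inner_apply]
    exact Finset.sum_nonpos fun i _ => (h i).2 _ (hy i)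

/-- The coupling map as a linear map. -/
def couplingLinear : BlockVec nx →ₗ[ℝ] BlockVec nlam where
  toFun := G.couplingMap
  map_add' x y := by
    ext m : 1
    change ∑ i, G.A m i (x i + y i) = ∑ i, G.A m i (x i) + ∑ i, G.A m i (y i)
    simp only [map_add, Finset.sum_add_distrib]
  map_smul' r x := by
    ext m : 1
    change ∑ i, G.A m i (r • x i) = r • ∑ i, G.A m i (x i)
    simp only [map_smul, Finset.smul_sum]

theorem inner_couplingTranspose (l : BlockVec nlam) (x : BlockVec nx) :
    inner ℝ (G.couplingTranspose l) x = inner ℝ l (G.couplingLinear x) := by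
  have e1 : inner ℝ (G.couplingTranspose l) x =
      ∑ i, ∑ m, inner ℝ (l m) (G.A m i (x i)) := by
    rw [PiLp.inner_apply]
    refine Finset.sum_congr rfl fun i _ => ?_
    change inner ℝ (∑ m, (ContinuousLinearMap.adjoint (G.A m i)) (l m)) (x i) = _
    simp only [sum_inner, ContinuousLinearMap.adjoint_inner_left]
  have e2 : inner ℝ l (G.couplingLinear x) = ∑ m, ∑ i, inner ℝ (l m) (G.A m i (x i)) := by
    rw [PiLp.inner_apply]
    refine Finset.sum_congr rfl fun m _ => ?_
    change inner ℝ (l m) (∑ i, G.A m i (x i)) = _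
    rw [inner_sum]
  rw [e1, e2, Finset.sum_comm]

theorem couplingMap_sub (x y : BlockVec nx) :
    G.couplingMap x - G.couplingMap y = G.couplingLinear (x - y) :=
  (map_sub G.couplingLinear x y).symm

theorem isClosed_Omega (h : G.ConvexRegular) : IsClosed G.Omega := by
  have : G.Omega = ⋂ i, {x : BlockVec nx | x i ∈ G.feasible i} := by
    ext x; simp [Omega]
  rw [this]
  exact isClosed_iInter fun i => (h.closed i).preimage (by fun_prop)

theorem convex_Omega (h : G.ConvexRegular) : Convex ℝ G.Omega :=
  fun _ hx _ hy _ _ ha hb hab i => h.convex i (hx i) (hy i) ha hb hab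

theorem isKKT_of_inner_nonneg {x : BlockVec nx} {l : BlockVec nlam} (hx : x ∈ G.Omega)
    (hvi : ∀ y ∈ G.Omega, 0 ≤ inner ℝ (G.pseudoGrad x + G.couplingTranspose l) (y - x))
    (hA : G.couplingMap x = G.couplingVec) : G.IsKKT x l := by
  refine ⟨⟨-(G.pseudoGrad x + G.couplingTranspose l), ⟨hx, fun y hy => ?_⟩, by abel⟩,
    sub_eq_zero.2 hA⟩
  rw [inner_neg_left]
  linarith [hvi y hy]

theorem IsKKT.isVGNE {G : GeneralizedGame nx nlam} (hG : G.ConvexRegular) {x : BlockVec nx}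
    {l : BlockVec nlam} (h : G.IsKKT x l) : G.IsVGNE x := by
  obtain ⟨⟨v, hv, he⟩, hA⟩ := h
  have hvi := G.mem_normalCone_Omega_iff.1 hv
  have hei : ∀ i, G.partialGrad i x + v i +
      ∑ m, (ContinuousLinearMap.adjoint (G.A m i)) (l m) = 0 := fun i =>
    congrArg (fun u : BlockVec nx => u i) he
  refine ⟨⟨⟨hv.1, sub_eq_zero.1 hA⟩, fun i y hy => ?_⟩, l, fun i => ⟨v i, hvi i, hei i⟩⟩
  have h1 := (hG.cost_convex i x).inner_gradient_le_sub (hG.cost_differentiable i x (x i)) y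
  rw [replaceBlock_self] at h1
  have hyi : y ∈ G.feasible i := by simpa [replaceBlock] using hy.1 i
  -- A unilateral deviation that stays feasible leaves `A x` unchanged, so the multiplier term does
  -- no work.
  have h2 : inner ℝ (G.couplingTranspose l) (replaceBlock x i y - x) = 0 := by
    rw [inner_couplingTranspose, ← couplingMap_sub, hy.2, sub_eq_zero.1 hA, sub_self,
      inner_zero_right]
  rw [replaceBlock_sub_inner] at h2
  have h3 := (hvi i).2 y hyi
  have h4 := congrArg (fun u => inner ℝ u (y - x i)) (hei i)
  simp only [inner_add_left, inner_zero_left] at h4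
  change inner ℝ (∑ m, (ContinuousLinearMap.adjoint (G.A m i)) (l m)) (y - x i) = 0 at h2
  change inner ℝ (G.partialGrad i x) (y - x i) ≤ _ at h1
  linarith

theorem IsVGNE.exists_isKKT {G : GeneralizedGame nx nlam} {x : BlockVec nx} (h : G.IsVGNE x) :
    ∃ l, G.IsKKT x l := by
  obtain ⟨⟨⟨hx, hA⟩, -⟩, l, hl⟩ := h
  choose v hv he using hl
  refine ⟨l, ⟨WithLp.toLp 2 v, G.mem_normalCone_Omega_iff.2 hv, ?_⟩, sub_eq_zero.2 hA⟩
  ext i : 1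
  exact he i

/-- Both points satisfy the same affine constraint, so the multipliers drop out when the conditions
are tested on `x - y`, and strong monotonicity remains. -/
theorem IsKKT.unique {G : GeneralizedGame nx nlam} {μ : ℝ} (hμ : 0 < μ)
    (hmon : ∀ x y, μ * ‖x - y‖ ^ 2 ≤ inner ℝ (G.pseudoGrad x - G.pseudoGrad y) (x - y))
    {x y : BlockVec nx} {l l' : BlockVec nlam} (h : G.IsKKT x l) (h' : G.IsKKT y l') : x = y := by
  obtain ⟨⟨v, hv, he⟩, hA⟩ := h
  obtain ⟨⟨v', hv', he'⟩, hA'⟩ := h'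
  have a1 := hv.2 y hv'.1
  have a2 := hv'.2 x hv.1
  have hz : G.couplingLinear (x - y) = 0 := by
    rw [← couplingMap_sub, sub_eq_zero.1 hA, sub_eq_zero.1 hA', sub_self]
  have hz' : G.couplingLinear (y - x) = 0 := by rw [← neg_sub, map_neg, hz, neg_zero]
  have b1 := congrArg (fun u => inner ℝ u (y - x)) he
  have b2 := congrArg (fun u => inner ℝ u (x - y)) he'
  simp only [inner_add_left, inner_zero_left, inner_couplingTranspose, hz, hz', inner_zero_right,
    add_zero] at b1 b2
  have c1 : inner ℝ (G.pseudoGrad x) (y - x) = -inner ℝ (G.pseudoGrad x) (x - y) := by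
    rw [← inner_neg_right, neg_sub]
  have c2 := hmon x y
  rw [inner_sub_left] at c2
  have : μ * ‖x - y‖ ^ 2 ≤ 0 := by linarith
  have h0 : ‖x - y‖ ^ 2 = 0 := le_antisymm (by nlinarith) (sq_nonneg _)
  exact sub_eq_zero.1 (norm_eq_zero.1 ((pow_eq_zero_iff two_ne_zero).1 h0))

theorem exists_kkt_inner_nonneg (hG : G.ConvexRegular) {μ θ : ℝ} (hμ : 0 < μ) (hθ : 0 < θ)
    (hF : G.StronglyMonotoneLipschitz μ θ) :
    ∃ x ∈ G.Omega, ∃ l, G.couplingMap x = G.couplingVec ∧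
      ∀ y ∈ G.Omega, 0 ≤ inner ℝ (G.pseudoGrad x + G.couplingTranspose l) (y - x) := by
  have hΩ := G.convex_Omega hG
  have hcl : IsClosed G.feasibleSet :=
    (G.isClosed_Omega hG).inter
      (isClosed_eq (LinearMap.continuous_of_finiteDimensional G.couplingLinear) continuous_const)
  have hcv : Convex ℝ G.feasibleSet :=
    hΩ.inter ((convex_singleton G.couplingVec).linear_preimage G.couplingLinear)
  obtain ⟨x, hx, hvi⟩ := exists_variational_solution hcl hcv hG.nonempty hμ hθ hF.1 hF.2
  obtain ⟨x₀, hx₀, hA₀⟩ := hG.slater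
  obtain ⟨l, hl⟩ := exists_multiplier G.couplingLinear hΩ hx₀ (x := x) (hA₀.trans hx.2.symm)
    (g := G.pseudoGrad x) fun y hy hyA => hvi y ⟨hy, hyA.trans hx.2⟩
  refine ⟨x, hx.1, l, hx.2, fun y hy => ?_⟩
  rw [inner_add_left, inner_couplingTranspose]
  exact hl y hy

end GeneralizedGame

end

noncomputable section

/-! ### The aggregative game as a tracking problem -/

namespace AggregativeGame

variable {I M Q : ℕ} {nx : Fin I → ℕ} {nlam : Fin M → ℕ} {nsig : Fin Q → ℕ}
  (G : AggregativeGame nx nlam nsig) {comm : Fin I → Fin I → Prop}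
  (DL : EstimateDesign comm G.interfLam) (DS : EstimateDesign comm G.interfSig)

/-- `x ↦ 𝐀 x` as a continuous linear map. -/
def stackedACLM : BlockVec nx →L[ℝ] DL.Est nlam :=
  LinearMap.toContinuousLinearMap
    { toFun := G.stackedA DL
      map_add' := fun x y => by
        ext m i : 2
        exact map_add (G.A m i.1) (x i.1) (y i.1)
      map_smul' := fun r x => by
        ext m i : 2
        exact map_smul (G.A m i.1) r (x i.1) }

/-- `x ↦ 𝐁 x` as a continuous linear map. -/
def stackedBCLM : BlockVec nx →L[ℝ] DS.Est nsig :=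
  LinearMap.toContinuousLinearMap
    { toFun := G.stackedB DS
      map_add' := fun x y => by
        ext q i : 2
        change (DS.copies q : ℝ) • G.B q i.1 (x i.1 + y i.1) =
          (DS.copies q : ℝ) • G.B q i.1 (x i.1) + (DS.copies q : ℝ) • G.B q i.1 (y i.1)
        rw [map_add, smul_add]
      map_smul' := fun r x => by
        ext q i : 2
        change (DS.copies q : ℝ) • G.B q i.1 (r • x i.1) =
          r • (DS.copies q : ℝ) • G.B q i.1 (x i.1)
        rw [map_smul, smul_comm] }

/-- Summing over the blocks and then over their holders, or over the agents and then over the blocks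
they keep. -/
theorem sum_holder_comm {P : ℕ} (S : Finset (Fin P × Fin I))
    (f : ∀ (p : Fin P) (i : Fin I), (p, i) ∈ S → ℝ) :
    ∑ p, ∑ i : {i : Fin I // (p, i) ∈ S}, f p i.1 i.2 =
      ∑ i, ∑ p : {p : Fin P // (p, i) ∈ S}, f p.1 i p.2 := by
  have e1 : ∀ p, ∑ i : {i : Fin I // (p, i) ∈ S}, f p i.1 i.2 =
      ∑ i, if h : (p, i) ∈ S then f p i h else 0 := fun p => by
    rw [← Finset.sum_subset (Finset.subset_univ (Finset.univ.filter fun i => (p, i) ∈ S))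
      fun i _ hi => dif_neg (by simpa using hi)]
    rw [Finset.sum_subtype (p := fun i => (p, i) ∈ S) _ (by simp)]
    exact Finset.sum_congr rfl fun i _ => (dif_pos i.2).symm
  have e2 : ∀ i, ∑ p : {p : Fin P // (p, i) ∈ S}, f p.1 i p.2 =
      ∑ p, if h : (p, i) ∈ S then f p i h else 0 := fun i => by
    rw [← Finset.sum_subset (Finset.subset_univ (Finset.univ.filter fun p => (p, i) ∈ S))
      fun p _ hp => dif_neg (by simpa using hp)]
    rw [Finset.sum_subtype (p := fun p => (p, i) ∈ S) _ (by simp)]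
    exact Finset.sum_congr rfl fun p _ => (dif_pos p.2).symm
  simp only [e1, e2]
  exact Finset.sum_comm

theorem adjoint_stackedACLM (l : DL.Est nlam) :
    ContinuousLinearMap.adjoint (G.stackedACLM DL) l = G.stackedATranspose DL l := by
  refine ext_inner_right ℝ fun x => ?_
  rw [ContinuousLinearMap.adjoint_inner_left, EstimateDesign.inner_est, PiLp.inner_apply]
  refine (sum_holder_comm DL.est fun m i h => inner ℝ (l m ⟨i, h⟩) (G.A m i (x i))).trans ?_
  refine Finset.sum_congr rfl fun i _ => ?_
  change _ = inner ℝ (∑ m : {m : Fin M // (m, i) ∈ DL.est},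
    (ContinuousLinearMap.adjoint (G.A m.1 i)) (l m.1 ⟨i, m.2⟩)) (x i)
  simp only [sum_inner, ContinuousLinearMap.adjoint_inner_left]

theorem adjoint_stackedBCLM (s : DS.Est nsig) :
    ContinuousLinearMap.adjoint (G.stackedBCLM DS) s = G.stackedBTranspose DS s := by
  refine ext_inner_right ℝ fun x => ?_
  rw [ContinuousLinearMap.adjoint_inner_left, EstimateDesign.inner_est, PiLp.inner_apply]
  refine (sum_holder_comm DS.est fun q i h =>
    inner ℝ (s q ⟨i, h⟩) ((DS.copies q : ℝ) • G.B q i (x i))).trans ?_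
  refine Finset.sum_congr rfl fun i _ => ?_
  change _ = inner ℝ (∑ q : {q : Fin Q // (q, i) ∈ DS.est},
    (DS.copies q.1 : ℝ) • (ContinuousLinearMap.adjoint (G.B q.1 i)) (s q.1 ⟨i, q.2⟩)) (x i)
  simp only [sum_inner, real_inner_smul_left, real_inner_smul_right,
    ContinuousLinearMap.adjoint_inner_left]

theorem step_eq_primalDualStep (α β : ℝ) :
    G.step DL DS α β = primalDualStep G.toGame.Omega (G.extPseudoGrad DS) (G.stackedBCLM DS)
      (DS.lapCLM nsig) (G.stackedACLM DL) (G.stackeda DL) (DL.lapCLM nlam) α β := by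
  funext ⟨x, s, z, l⟩
  simp only [step, primalDualStep, adjoint_stackedACLM, adjoint_stackedBCLM]
  rfl

/-- Blocks missing at agent `i` have `A m i = 0`, so nothing is lost. -/
theorem adjoint_stackedACLM_consensus (y : BlockVec nlam) :
    ContinuousLinearMap.adjoint (G.stackedACLM DL) (DL.consensus y) =
      G.toGame.couplingTranspose y := by
  rw [adjoint_stackedACLM]
  ext i : 1
  change ∑ m : {m : Fin M // (m, i) ∈ DL.est}, (ContinuousLinearMap.adjoint (G.A m.1 i)) (y m.1) =
    ∑ m, (ContinuousLinearMap.adjoint (G.A m i)) (y m)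
  rw [← Finset.sum_subtype (Finset.univ.filter fun m => (m, i) ∈ DL.est) (by simp)
    fun m => (ContinuousLinearMap.adjoint (G.A m i)) (y m)]
  refine Finset.sum_subset (Finset.subset_univ _) fun m _ hm => ?_
  have hm' : (m, i) ∉ G.interfLam := fun h => hm (by simpa using DL.interf_subset h)
  rw [G.A_eq_zero m i hm', map_zero, _root_.zero_apply]

theorem sum_stackedA_sub (x : BlockVec nx) (m : Fin M) :
    ∑ i, (G.stackedA DL x - G.stackeda DL) m i =
      G.toGame.couplingMap x m - G.toGame.couplingVec m := by
  change ∑ i : DL.Holder m, (G.A m i.1 (x i.1) - G.a m i.1) =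
    ∑ i, G.A m i (x i) - ∑ i, G.a m i
  rw [← Finset.sum_sub_distrib]
  refine DL.sum_holder m (fun i => G.A m i (x i) - G.a m i) fun i hi => ?_
  rw [G.A_eq_zero m i hi, G.a_eq_zero m i hi, _root_.zero_apply, sub_zero]

/-- The factor `N_q` in `𝐁` and `𝐛` compensates for the `N_q` copies: the mean of the local terms is
the aggregate. -/
theorem sum_consensus_aggregation (x : BlockVec nx) (q : Fin Q) :
    ∑ i, DS.consensus (G.aggregation x) q i =
      ∑ i, (G.stackedB DS x + G.stackedb DS) q i := by
  change ∑ _i : DS.Holder q, ∑ i, (G.B q i (x i) + G.b q i) =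
    ∑ i : DS.Holder q, ((DS.copies q : ℝ) • G.B q i.1 (x i.1) + (DS.copies q : ℝ) • G.b q i.1)
  rw [Finset.sum_const, Finset.card_univ]
  simp only [← smul_add]
  rw [← Finset.smul_sum, DS.sum_holder q (fun i => G.B q i (x i) + G.b q i) fun i hi => by
    rw [G.B_eq_zero q i hi, G.b_eq_zero q i hi, _root_.zero_apply, add_zero],
    Nat.cast_smul_eq_nsmul]
  rfl

theorem stackedB_add_sub_mem (x : BlockVec nx) :
    G.stackedB DS x + G.stackedb DS - DS.consensus (G.aggregation x) ∈
      (DS.consensusSpace nsig)ᗮ := by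
  refine DS.mem_consensusSpace_orthogonal fun q => ?_
  have := G.sum_consensus_aggregation DS x q
  change ∑ i, ((G.stackedB DS x + G.stackedb DS) q i - DS.consensus (G.aggregation x) q i) = 0
  rw [Finset.sum_sub_distrib, this, sub_self]

theorem stackedBCLM_sub_mem (x y : BlockVec nx) :
    G.stackedBCLM DS (x - y) - (DS.consensus (G.aggregation x) - DS.consensus (G.aggregation y)) ∈
      (DS.consensusSpace nsig)ᗮ := by
  have h := sub_mem (G.stackedB_add_sub_mem DS x) (G.stackedB_add_sub_mem DS y)
  have e : G.stackedBCLM DS (x - y) = G.stackedB DS x - G.stackedB DS y :=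
    map_sub (G.stackedBCLM DS) x y
  rw [e]
  convert h using 1
  abel

theorem continuous_consensus_aggregation :
    Continuous fun x => DS.consensus (G.aggregation x) := by
  unfold EstimateDesign.consensus aggregation
  fun_prop

/-- On exact aggregates, the extended pseudo-gradient is the pseudo-gradient. -/
theorem extPseudoGrad_consensus (hf : ∀ i, Differentiable ℝ (Function.uncurry (G.fbar i)))
    (x : BlockVec nx) :
    G.extPseudoGrad DS x (DS.consensus (G.aggregation x)) = G.toGame.pseudoGrad x := by
  ext i : 1
  set s₀ := DS.agentEst (DS.consensus (G.aggregation x)) i with hs₀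
  set H : Vec (nx i) × NeighborVec nsig DS.est i → ℝ := fun p => G.localCost DS i p.1 p.2 with hH
  have hHd : Differentiable ℝ H := by
    have e : H = Function.uncurry (G.fbar i) ∘ fun p => (p.1, DS.restrict i p.2) := rfl
    rw [e]
    refine (hf i).comp (differentiable_fst.prodMk ((differentiable_piLp 2).2 fun q => ?_))
    change Differentiable ℝ fun p : Vec (nx i) × NeighborVec nsig DS.est i =>
      p.2 ⟨q.1, DS.interf_subset q.2⟩
    fun_prop
  let L : Vec (nx i) →L[ℝ] NeighborVec nsig DS.est i :=
    LinearMap.toContinuousLinearMap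
      { toFun := fun v => WithLp.toLp 2 fun q => G.B q.1 i v
        map_add' := fun v w => by
          ext q : 1
          exact map_add (G.B q.1 i) v w
        map_smul' := fun r v => by
          ext q : 1
          exact map_smul (G.B q.1 i) r v }
  set φ : Vec (nx i) → NeighborVec nsig DS.est i := fun y =>
    DS.agentEst (DS.consensus (G.aggregation (replaceBlock x i y))) i with hφ
  have hφx : φ (x i) = s₀ := by rw [hφ, hs₀]; simp only [replaceBlock_self]
  have hφL : φ = fun y => s₀ + L (y - x i) := by
    funext y
    ext q : 1
    change ∑ j, (G.B q.1 j (replaceBlock x i y j) + G.b q.1 j) =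
      ∑ j, (G.B q.1 j (x j) + G.b q.1 j) + G.B q.1 i (y - x i)
    rw [← sub_eq_iff_eq_add', ← Finset.sum_sub_distrib, Finset.sum_eq_single i]
    · simp [replaceBlock]
    · intro j _ hj
      simp [replaceBlock, hj]
    · simp
  -- Exact aggregates depend on the agent's own action affinely, with linear part `L = B̃_i`. The
  -- claim is the chain rule for `y ↦ H (y, φ y)`, using joint differentiability of `H`.
  have hφd : HasFDerivAt φ L (x i) := by
    rw [hφL]
    exact (L.hasFDerivAt.comp (x i) ((hasFDerivAt_id (x i)).sub_const (x i))).const_add s₀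
  have hH0 : HasFDerivAt H (fderiv ℝ H (x i, s₀)) (x i, s₀) := (hHd _).hasFDerivAt
  have d1 : fderiv ℝ (fun y => G.localCost DS i y s₀) (x i) =
      (fderiv ℝ H (x i, s₀)).comp (ContinuousLinearMap.inl ℝ _ _) := by
    have h := HasFDerivAt.comp (g := H) (x i) hH0 (hasFDerivAt_prodMk_left (𝕜 := ℝ) (x i) s₀)
    exact h.fderiv
  have d2 : fderiv ℝ (fun t => G.localCost DS i (x i) t) s₀ =
      (fderiv ℝ H (x i, s₀)).comp (ContinuousLinearMap.inr ℝ _ _) := by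
    have h := HasFDerivAt.comp (g := H) s₀ hH0 (hasFDerivAt_prodMk_right (𝕜 := ℝ) (x i) s₀)
    exact h.fderiv
  have hcost : (fun y => G.toGame.cost i (replaceBlock x i y)) = fun y => H (y, φ y) := by
    funext y
    change G.fbar i (replaceBlock x i y i) _ = G.fbar i y _
    have : replaceBlock x i y i = y := by simp [replaceBlock]
    rw [this]
    rfl
  have d3 : fderiv ℝ (fun y => G.toGame.cost i (replaceBlock x i y)) (x i) =
      (fderiv ℝ H (x i, s₀)).comp ((ContinuousLinearMap.id ℝ _).prod L) := by
    rw [hcost]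
    refine HasFDerivAt.fderiv
      (HasFDerivAt.comp (g := H) (x i) ?_ ((hasFDerivAt_id (x i)).prodMk hφd))
    rw [hφx]
    exact hH0
  change gradient (fun y => G.localCost DS i y s₀) (x i) +
      ∑ q : {q : Fin Q // (q, i) ∈ DS.est}, (ContinuousLinearMap.adjoint (G.B q.1 i))
        ((gradient (fun t => G.localCost DS i (x i) t) s₀) q) =
    gradient (fun y => G.toGame.cost i (replaceBlock x i y)) (x i)
  refine ext_inner_right ℝ fun v => ?_
  have hsum : inner ℝ (∑ q : {q : Fin Q // (q, i) ∈ DS.est},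
      (ContinuousLinearMap.adjoint (G.B q.1 i))
        ((gradient (fun t => G.localCost DS i (x i) t) s₀) q)) v =
      inner ℝ (gradient (fun t => G.localCost DS i (x i) t) s₀) (L v) := by
    rw [sum_inner, PiLp.inner_apply]
    exact Finset.sum_congr rfl fun q _ => ContinuousLinearMap.adjoint_inner_left _ _ _
  rw [inner_add_left, hsum, real_inner_gradient, real_inner_gradient, real_inner_gradient, d1, d2,
    d3]
  simp only [ContinuousLinearMap.comp_apply, ContinuousLinearMap.inl_apply,
    ContinuousLinearMap.inr_apply, ContinuousLinearMap.prod_apply, ContinuousLinearMap.id_apply]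
  rw [← map_add]
  simp

theorem trackingData {μ θ c : ℝ} (hμ : 0 < μ) (hθ : 0 < θ) (hc : 0 < c)
    (hfbar : ∀ i, Differentiable ℝ (Function.uncurry (G.fbar i)))
    (hconv : G.toGame.ConvexRegular) (hmon : G.toGame.StronglyMonotoneLipschitz μ θ)
    (hSbal : DS.BalancedWeights) (hext : G.ExtLipschitz DS θ)
    (hcoer : ∀ u ∈ (DS.consensusSpace nsig)ᗮ, c * ‖u‖ ^ 2 ≤ inner ℝ (DS.lapCLM nsig u) u) :
    TrackingData G.toGame.Omega G.toGame.pseudoGrad (G.extPseudoGrad DS) (G.stackedBCLM DS)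
      (DS.lapCLM nsig) (DS.consensusSpace nsig) (fun x => DS.consensus (G.aggregation x)) μ θ c where
  closed := G.toGame.isClosed_Omega hconv
  convex := G.toGame.convex_Omega hconv
  nonempty := hconv.nonempty.mono Set.inter_subset_left
  cons_mem _ := DS.consensus_mem _
  cons_sub := G.stackedBCLM_sub_mem DS
  cons_continuous := G.continuous_consensus_aggregation DS
  LS_mem := hSbal.lap_mem
  LS_eq_zero := by
    rintro _ ⟨v, rfl⟩
    exact DS.lap_consensus v
  coercive := hcoer
  extends_F := G.extPseudoGrad_consensus DS hfbar
  F_mono := hmon.1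
  F_lip := hmon.2
  Ft_lip := hext
  μ_pos := hμ
  θ_pos := hθ
  c_pos := hc

theorem exists_isPrimalDualSolution {μ θ : ℝ} (hμ : 0 < μ) (hθ : 0 < θ)
    (hconv : G.toGame.ConvexRegular) (hmon : G.toGame.StronglyMonotoneLipschitz μ θ)
    (hLconn : DL.StronglyConnected) (hLsymm : DL.SymmetricWeights) {α : ℝ} (hα : 0 < α) :
    ∃ x z l, IsPrimalDualSolution G.toGame.Omega G.toGame.pseudoGrad (G.stackedACLM DL)
      (G.stackeda DL) (DL.lapCLM nlam) α x z l := by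
  obtain ⟨x, hx, l, hA, hvi⟩ := G.toGame.exists_kkt_inner_nonneg hconv hμ hθ hmon
  -- Feasibility of `x` says that the local residuals sum to zero in each block, which is the
  -- solvability condition for `z`.
  obtain ⟨z, hz⟩ := hLsymm.exists_lap_eq hLconn (r := G.stackedA DL x - G.stackeda DL) fun m => by
    rw [sum_stackedA_sub, hA, sub_self]
  refine ⟨x, z, DL.consensus (α • l), hx, fun y hy => ?_, DL.lap_consensus _, ?_⟩
  · have e : DL.consensus (α • l) = α • DL.consensus l := rfl
    rw [e, map_smul, ← smul_add, adjoint_stackedACLM_consensus, real_inner_smul_left]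
    exact mul_nonneg hα.le (hvi y hy)
  · have e : G.stackedACLM DL x = G.stackedA DL x := rfl
    rw [hz, e]
    abel

theorem isKKT_of_isPrimalDualSolution (hLconn : DL.StronglyConnected)
    (hLsymm : DL.SymmetricWeights) {α : ℝ} (hα : 0 < α) {x : BlockVec nx} {z l : DL.Est nlam}
    (h : IsPrimalDualSolution G.toGame.Omega G.toGame.pseudoGrad (G.stackedACLM DL)
      (G.stackeda DL) (DL.lapCLM nlam) α x z l) :
    ∃ y : BlockVec nlam, l = DL.consensus (α • y) ∧ G.toGame.IsKKT x y := by
  obtain ⟨hx, hvi, hl, hz⟩ := h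
  obtain ⟨v, rfl⟩ := hLsymm.balanced.mem_consensusSpace hLconn (y := l) (by
    rw [← DL.lapCLM_apply, hl, inner_zero_left])
  have hv : v = α • α⁻¹ • v := (smul_inv_smul₀ hα.ne' v).symm
  refine ⟨α⁻¹ • v, by rw [← hv], G.toGame.isKKT_of_inner_nonneg hx (fun y hy => ?_) ?_⟩
  · have h1 := hvi y hy
    have e : DL.consensus v = α • DL.consensus (α⁻¹ • v) := congrArg DL.consensus hv
    rw [e, map_smul, ← smul_add, adjoint_stackedACLM_consensus, real_inner_smul_left] at h1
    exact nonneg_of_mul_nonneg_right h1 hα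
  · have h1 : DL.lap z = G.stackedA DL x - G.stackeda DL := by
      have : DL.lap z - G.stackedA DL x + G.stackeda DL = 0 := hz
      rw [← sub_eq_zero, ← this]
      abel
    ext m : 1
    -- Testing `𝐋 z = 𝐀 x - 𝐚` against the consensus copy of `A x - a` gives `0` on the left and `‖A
    -- x - a‖²` on the right.
    have h2 := Submodule.inner_right_of_mem_orthogonal
      (DL.consensus_mem (G.toGame.couplingMap x - G.toGame.couplingVec))
      (hLsymm.balanced.lap_mem z)
    have h3 : ∀ m, inner ℝ ((G.toGame.couplingMap x - G.toGame.couplingVec) m)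
        (∑ i, DL.lap z m i) = ‖(G.toGame.couplingMap x - G.toGame.couplingVec) m‖ ^ 2 := by
      intro m
      rw [h1, sum_stackedA_sub, ← real_inner_self_eq_norm_sq]
      rfl
    have h4 : ∑ m, ‖(G.toGame.couplingMap x - G.toGame.couplingVec) m‖ ^ 2 = 0 := by
      rw [← h2, EstimateDesign.inner_est]
      refine Finset.sum_congr rfl fun m _ => ?_
      rw [← h3 m, inner_sum]
      rfl
    have h5 := (Finset.sum_eq_zero_iff_of_nonneg fun m _ => sq_nonneg _).1 h4 m (Finset.mem_univ m)
    exact sub_eq_zero.1 (norm_eq_zero.1 ((pow_eq_zero_iff two_ne_zero).1 h5))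

end AggregativeGame

end

/-! ### The convergence theorem -/

theorem theorem2 {I M Q : ℕ} {nx : Fin I → ℕ} {nlam : Fin M → ℕ} {nsig : Fin Q → ℕ}
    (G : AggregativeGame nx nlam nsig) (comm : Fin I → Fin I → Prop)
    (DL : EstimateDesign comm G.interfLam) (DS : EstimateDesign comm G.interfSig)
    (μ θ : ℝ) (hμ : 0 < μ) (hθ : 0 < θ)
    -- the functions `f̄_i` are differentiable, so that the extended pseudo-gradient makes sense
    (hfbar : ∀ i, Differentiable ℝ (Function.uncurry (G.fbar i)))
    (hconv : G.toGame.ConvexRegular)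
    (hmon : G.toGame.StronglyMonotoneLipschitz μ θ)
    (hLund : DL.Undirected) (hLconn : DL.StronglyConnected) (hLsymm : DL.SymmetricWeights)
    (hSconn : DS.StronglyConnected) (hSbal : DS.BalancedWeights)
    (hext : G.ExtLipschitz DS θ) :
    ∃ α₀ > (0 : ℝ), ∀ α : ℝ, 0 < α → α < α₀ →
      ∃ β₀ > (0 : ℝ), ∀ β : ℝ, 0 < β → β < β₀ →
        ∀ (x0 : BlockVec nx) (z0 l0 : DL.Est nlam),
          ∃ (xs : BlockVec nx) (zs : DL.Est nlam) (ls : BlockVec nlam),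
            Filter.Tendsto (G.iter DL DS α β x0 z0 l0) Filter.atTop
              (nhds (xs, DS.consensus (G.aggregation xs), zs, DL.consensus (α • ls))) ∧
            G.toGame.IsKKT xs ls ∧
            G.toGame.IsVGNE xs ∧
            ∀ x : BlockVec nx, G.toGame.IsVGNE x → x = xs := by
  obtain ⟨c, hc, hcoer⟩ := hSbal.exists_coercive (n := nsig) hSconn
  have T := G.trackingData DS hμ hθ hc hfbar hconv hmon hSbal hext hcoer
  -- Here `c` is the coercivity constant of the aggregation Laplacian on the complement of
  -- consensus.
  refine ⟨μ * c / θ ^ 2, by positivity, fun α hα hα' => ?_⟩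
  obtain ⟨β₀, hβ₀, hlim⟩ := T.exists_stepSize_tendsto (G.stackedACLM DL) (G.stackeda DL)
    (DL.lapCLM nlam) hLsymm.inner_lap_comm hα hα'
    (G.exists_isPrimalDualSolution DL hμ hθ hconv hmon hLconn hLsymm hα)
  refine ⟨β₀, hβ₀, fun β hβ hβ' x0 z0 l0 => ?_⟩
  obtain ⟨x, z, l, hsol, hconvg⟩ := hlim β hβ hβ' (G.initState DL DS x0 z0 l0)
    (G.stackedB_add_sub_mem DS x0)
  obtain ⟨ls, rfl, hkkt⟩ := G.isKKT_of_isPrimalDualSolution DL hLconn hLsymm hα hsol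
  refine ⟨x, z, ls, ?_, hkkt, hkkt.isVGNE hconv, fun y hy => ?_⟩
  · rw [← G.step_eq_primalDualStep DL DS] at hconvg
    exact hconvg
  · obtain ⟨l', hl'⟩ := hy.exists_isKKT
    exact hl'.unique hμ hmon.1 hkkt
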